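/- Let $n\ge 0$. Write $[n]=\{1,\dots,n\}$ and consider the $2n$ symbols $1,\dots,n,\bar1,\dots,\bar n$, with the bar operation as an involution. Definitions. (a) A type-B noncrossing partition of $[n]$ is a partition of $\{1,\dots,n,\bar1,\dots,\bar n\}$ such that (i) barring all elements of a block gives a block; (ii) at most one block (the zero-block) is mapped to itself by barring; (iii) if the symbols are placed clockwise around a circle in the order $1,\dots,n,\bar1,\dots,\bar n$, there are no four elements $a,b,c,d$ in clockwise order such that $a,c$ lie in one block and $b,d$ lie in a different block. $NC^B_n$ is the set of these partitions ordered by refinement ($\pi\le\pi'$ if every block of $\pi$ is contained in a block of $\pi'$). (b) A signed permutation is a word $b=b_1\cdots b_n$ in which each of $1,\dots,n$ appears exactly once, barred or unbarred. It is $(21,\bar2\,\bar1)$-avoiding if there are no $i<j$ such that $b_i,b_j$ are both barred or both unbarred and $|b_i|>|b_j|$, where $|\cdot|$ removes the bar. Its descent set $\mathrm{Des}(b)\subseteq[n]$ consists of all $i\le n-1$ with $b_i>b_{i+1}$ in the total order $1<2<\cdots<n<\bar n<\cdots<\bar2<\bar1$, together with $n$ if $b_n$ is barred. $P^B_n$ is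 the set of $(21,\bar2\,\bar1)$-avoiding signed permutations, with $b<b'$ if and only if $\mathrm{Des}(b)\subsetneq\mathrm{Des}(b')$. (c) A finite poset is ranked, with rank function $\mathrm{rk}$, if $\mathrm{rk}$ takes values in the nonnegative integers, is $0$ on minimal elements, and increases by exactly $1$ along every covering relation. Its rank sizes are $W_k=\#\{x:\mathrm{rk}(x)=k\}$, and its rank generating function is $\sum_x q^{\mathrm{rk}(x)}$. Theorem. For every $n\ge0$: 1. $P^B_n$ is an extension of $NC^B_n$: there is a bijection $f:NC^B_n\to P^B_n$ such that $\pi<\pi'$ implies $f(\pi)<f(\pi')$. 2. $NC^B_n$ is ranked by $\mathrm{rk}(\pi)=n-\#\{\text{pairs }\{\beta,\bar\beta\}\text{ of non-zero blocks of }\pi\}$, $P^B_n$ is ranked by $\mathrm{rk}(b)=\#\mathrm{Des}(b)$, and the two posets have the same rank generating function. The number of elements of $P^B_n$ of rank $k$ is $\binom nk^2$ for every $k\ge 0$. 3. $P^B_n$ is rank-symmetric ($W_k=W_{r-k}$ for $0\le k\le r$, where $r$ is the largest rank) and rank-unimodal ($W_0\le\cdots\le W_m\ge W_{m+1}\ge\cdots$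 for some $m$). 4. $P^B_n$ is self-dual, that is, isomorphic to its order dual. 5. $P^B_n$ is strongly Sperner: for every $k\ge0$, the maximum cardinality of a union of $k$ antichains of $P^B_n$ is the sum of the $k$ largest rank sizes (where missing rank sizes count as $0$). -/

import Mathlib

/-! ### Ranked posets -/

/-- `ρ` is the rank function of a ranked (finite) poset: minimal elements have rank `0`, and the
rank goes up by exactly one along every covering relation. On a finite poset there is at most
one such function. -/
def IsRankFunction {α : Type*} [PartialOrder α] (ρ : α → ℕ) : Prop :=
  (∀ x : α, IsMin x → ρ x = 0) ∧ ∀ x y : α, x ⋖ y → ρ y = ρ x + 1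

/-- The number of elements of rank `k`. -/
noncomputable def rankSize {α : Type*} (ρ : α → ℕ) (k : ℕ) : ℕ :=
  {x : α | ρ x = k}.ncard

/-- The rank generating function `∑ x, q ^ (rank of x)`. -/
noncomputable def rankGenFun {α : Type*} [Fintype α] (ρ : α → ℕ) : Polynomial ℕ :=
  ∑ x : α, Polynomial.X ^ ρ x

/-- Rank-symmetry: if `r` is the largest rank, there are as many elements of rank `k` as of
rank `r - k`, for all `0 ≤ k ≤ r`. -/
def RankSymmetric {α : Type*} (ρ : α → ℕ) : Prop :=
  ∃ r : ℕ, IsGreatest (Set.range ρ) r ∧ ∀ k ≤ r, rankSize ρ k = rankSize ρ (r - k)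

/-- Rank-unimodality: the rank sizes weakly increase up to some rank, then weakly decrease. -/
def RankUnimodal {α : Type*} (ρ : α → ℕ) : Prop :=
  ∃ m : ℕ, MonotoneOn (rankSize ρ) (Set.Iic m) ∧ AntitoneOn (rankSize ρ) (Set.Ici m)

/-- The strong Sperner property of a finite poset with rank function `ρ`: for every `k`, the
maximum cardinality of a union of `k` antichains is the sum of the `k` largest rank sizes
(the latter being the maximum of the sums of the sizes of `k` distinct ranks; numbers above the
largest rank are empty ranks). -/
def StronglySperner {α : Type*} [PartialOrder α] (ρ : α → ℕ) : Prop :=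
  ∀ k : ℕ, ∃ m : ℕ,
    IsGreatest {s : ℕ | ∃ A : Fin k → Set α,
      (∀ i, IsAntichain (· ≤ ·) (A i)) ∧ (⋃ i, A i).ncard = s} m ∧
    IsGreatest {s : ℕ | ∃ K : Finset ℕ, K.card = k ∧ ∑ i ∈ K, rankSize ρ i = s} m

/-- A poset is self-dual if it is isomorphic to its order dual. -/
def SelfDual (α : Type*) [PartialOrder α] : Prop :=
  Nonempty (α ≃o αᵒᵈ)

/-! ### Signed symbols -/

/-- The symbols `1, …, n` and `1̄, …, n̄`; `(i, false)` is the unbarred symbol `i + 1`,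
and `(i, true)` is the barred symbol with absolute value `i + 1`. -/
abbrev SignedSymbol (n : ℕ) : Type := Fin n × Bool

namespace SignedSymbol

/-- The absolute value of a symbol. -/
def abs {n : ℕ} (a : SignedSymbol n) : Fin n := a.1

/-- Whether a symbol is barred. -/
def barred {n : ℕ} (a : SignedSymbol n) : Bool := a.2

/-- The bar involution. -/
def bar {n : ℕ} (a : SignedSymbol n) : SignedSymbol n := (a.1, !a.2)

/-- Position on the circle, on which `1, 2, …, n, 1̄, 2̄, …, n̄` are placed clockwise. -/
def circlePos {n : ℕ} (a : SignedSymbol n) : ℕ :=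
  if a.barred then n + a.abs else a.abs

/-- Position in the total order `1 < 2 < ⋯ < n < n̄ < ⋯ < 2̄ < 1̄` (counted from `0`). -/
def linePos {n : ℕ} (a : SignedSymbol n) : ℕ :=
  if a.barred then 2 * n - 1 - a.abs else a.abs

end SignedSymbol

/-! ### The poset of type-B noncrossing partitions -/

/-- Type-B partitions of `{1, …, n}`: partitions of the `2n` signed symbols whose set of blocks
is closed under barring, with at most one block (the zero-block) invariant under barring. -/
def IsTypeBPartition {n : ℕ} (π : Setoid (SignedSymbol n)) : Prop :=
  (∀ β ∈ π.classes, SignedSymbol.bar '' β ∈ π.classes) ∧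
    {β ∈ π.classes | SignedSymbol.bar '' β = β}.Subsingleton

/-- No four elements `a, b, c, d` in clockwise order around the circle are such that `a, c` lie
in one block and `b, d` in another one. Up to a rotation of `(a, b, c, d)`, which at most
exchanges the roles of the two blocks, clockwise order means increasing position. -/
def IsNoncrossing {n : ℕ} (π : Setoid (SignedSymbol n)) : Prop :=
  ∀ a b c d : SignedSymbol n,
    a.circlePos < b.circlePos → b.circlePos < c.circlePos → c.circlePos < d.circlePos →
      π a c → π b d → π a b

/-- The type-B noncrossing partitions. Their order is inherited from `Setoid`, hence is
refinement: `π ≤ π'` iff elements in the same block of `π` are in the same block of `π'`. -/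
abbrev NCB (n : ℕ) : Type :=
  {π : Setoid (SignedSymbol n) // IsTypeBPartition π ∧ IsNoncrossing π}

/-- `n` minus the number of pairs `{β, β̄}` of non-zero blocks. -/
noncomputable def NCB.rank {n : ℕ} (π : NCB n) : ℕ :=
  n - {p : Set (Set (SignedSymbol n)) | ∃ β ∈ π.1.classes,
    SignedSymbol.bar '' β ≠ β ∧ p = {β, SignedSymbol.bar '' β}}.ncard

instance NCB.instFinite (n : ℕ) : Finite (NCB n) :=
  Finite.of_injective (fun π : NCB n => fun a b : SignedSymbol n => π.1 a b) (by
    intro π ρ h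
    apply Subtype.ext
    apply Setoid.ext
    intro a b
    exact iff_of_eq (congrFun (congrFun h a) b))

noncomputable instance NCB.instFintype (n : ℕ) : Fintype (NCB n) := Fintype.ofFinite _

/-! ### The poset of pattern-avoiding signed permutations -/

/-- Signed permutations (elements of the hyperoctahedral group) as words `b₁ b₂ … bₙ` in which
each of the symbols `1, …, n` appears exactly once, barred or not. -/
def SignedPerm (n : ℕ) : Type :=
  {b : Fin n → SignedSymbol n // Function.Bijective fun i => (b i).abs}

namespace SignedPerm

/-- `b` avoids both `21` and `2̄ 1̄`: there are no positions `i < j` whose symbols are both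
barred or both unbarred and such that `|b_i| > |b_j|`. -/
def Avoids {n : ℕ} (b : SignedPerm n) : Prop :=
  ¬ ∃ i j : Fin n, i < j ∧ (b.1 i).barred = (b.1 j).barred ∧ (b.1 j).abs < (b.1 i).abs

/-- The descent set. The position `i : Fin n` stands for `i + 1`; a position other than the last
one is a descent if `b_i > b_{i+1}` in the order `1 < ⋯ < n < n̄ < ⋯ < 1̄`, and the last position
is a descent if its symbol is barred. -/
def Des {n : ℕ} (b : SignedPerm n) : Set (Fin n) :=
  {i | (∃ h : (i : ℕ) + 1 < n, (b.1 ⟨i + 1, h⟩).linePos < (b.1 i).linePos) ∨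
    ((i : ℕ) + 1 = n ∧ (b.1 i).barred = true)}

end SignedPerm

/-- The signed permutations that avoid `21` and `2̄ 1̄`. -/
def PB (n : ℕ) : Type := {b : SignedPerm n // b.Avoids}

namespace PB

/-- The descent set of an element of `PB n`. -/
def Des {n : ℕ} (b : PB n) : Set (Fin n) := b.1.Des

/-- `b < b'` iff the descent set of `b` is strictly contained in that of `b'`. -/
instance instPartialOrder (n : ℕ) : PartialOrder (PB n) where
  le b b' := b = b' ∨ b.Des ⊂ b'.Des
  lt b b' := b.Des ⊂ b'.Des
  le_refl b := Or.inl rfl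
  le_trans a b c hab hbc := by
    rcases hab with rfl | hab
    · exact hbc
    · rcases hbc with rfl | hbc
      · exact Or.inr hab
      · exact Or.inr (hab.trans hbc)
  lt_iff_le_not_ge a b := by
    constructor
    · intro h
      refine ⟨Or.inr h, ?_⟩
      rintro (rfl | h')
      · exact (ssubset_irrefl _ h)
      · exact ssubset_irrefl _ (h.trans h')
    · rintro ⟨rfl | h, h'⟩
      · exact absurd (Or.inl rfl) h'
      · exact h
  le_antisymm a b hab hba := by
    rcases hab with h | hab
    · exact h
    · rcases hba with h | hba
      · exact h.symm
      · exact absurd (hab.trans hba) (ssubset_irrefl _)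

/-- The number of descents. -/
noncomputable def rank {n : ℕ} (b : PB n) : ℕ := b.Des.ncard

instance instFinite (n : ℕ) : Finite (PB n) :=
  Finite.of_injective (fun b : PB n => b.1.1) (fun _ _ h => Subtype.ext (Subtype.ext h))

noncomputable instance instFintype (n : ℕ) : Fintype (PB n) := Fintype.ofFinite _

end PB

/-!
In a word avoiding `21` and `2̄ 1̄` the unbarred symbols increase and the barred ones decrease in
the order `1 < ⋯ < n < n̄ < ⋯ < 1̄`, so a position is a descent exactly when its symbol is barred
(`PB.mem_Des_iff`), and the word is determined by the set `S` of positions and the set `T` of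
absolute values of its barred symbols. These are arbitrary subsets of the same size
(`PB.pairEquiv`), and words are compared through `S` alone. So `PB n` is the Boolean lattice with
every subset `S` replaced by an antichain of `n.choose S.card` elements: its rank sizes are
`n.choose k ^ 2`, complementation makes it self-dual, and the strong Sperner property follows from
the Lubell–Yamamoto–Meshalkin inequality for antichains of subsets together with a fractional
knapsack bound (`PB.ncard_iUnion_antichain_le`, `sum_mul_le_sum_of_maximal`).

A type-B noncrossing partition is unrolled to a relation on `ℤ` with period `2 * n` that is
invariant under translation by `n`. An opener is an integer related to none of its `n`
predecessors, a closer one related to none of its `n` successors. Every non-zero block contains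
exactly one opener and one closer, so modulo `n` there are as many openers as closers, namely one
for each pair of non-zero blocks (`NCB.IsTransversal.card_eq`). The sets of openers and closers
determine the partition (`IsTypeBRel.rel_iff_rel`), and any two subsets of the same size occur: read
them as the opening and closing parentheses of a periodic word, and relate two integers if they
have the same height and the word does not go below this height in between
(`IsHeight.isTypeBRel`). Taking complements gives a bijection from `NCB n` to the pairs `(S, T)`,
hence to `PB n`. Coarser partitions have fewer openers, by definition, so this bijection is order
preserving (`NCB.openers_ssubset_of_lt`), and it preserves ranks.

It remains to see that the rank of `NCB n` goes up by one along a covering relation `π ⋖ π'`. It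
goes up by at least one by strict monotonicity. Merging the `π`-blocks of two neighbours in a block
of `π'`, and then the bars of these blocks, gives a noncrossing partition between `π` and `π'`
(`IsNoncrossingRel.mergeRel`), which must be `π'`. So the number of blocks drops by at most two;
as it is twice the number of pairs of non-zero blocks, up to one zero-block, the number of pairs
drops by at most one (`NCB.card_openers_le_of_covBy`).
-/

/-! ### Pattern-avoiding signed permutations as pairs of subsets -/

/-- Pairs of subsets of `Fin n` of the same cardinality. -/
abbrev EqualCardPair (n : ℕ) : Type :=
  {p : Finset (Fin n) × Finset (Fin n) // p.1.card = p.2.card}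

namespace PB

variable {n : ℕ}

/-- The set of positions that carry a barred symbol. -/
def barredPositions (b : PB n) : Finset (Fin n) :=
  Finset.univ.filter fun i => (b.1.1 i).2 = true

/-- The set of absolute values of the barred symbols. -/
def barredValues (b : PB n) : Finset (Fin n) :=
  b.barredPositions.image fun i => (b.1.1 i).1

theorem mem_barredPositions {b : PB n} {i : Fin n} :
    i ∈ b.barredPositions ↔ (b.1.1 i).2 = true := by
  simp [barredPositions]

theorem abs_injective (b : PB n) : Function.Injective fun i => (b.1.1 i).1 :=
  b.1.2.injective

theorem abs_lt_of_lt (b : PB n) {i j : Fin n} (hij : i < j) (h : (b.1.1 i).2 = (b.1.1 j).2) :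
    (b.1.1 i).1 < (b.1.1 j).1 := by
  have h1 : ¬ (b.1.1 j).1 < (b.1.1 i).1 := fun h' => b.2 ⟨i, j, hij, h, h'⟩
  exact lt_of_le_of_ne (not_lt.1 h1) fun h' => hij.ne (b.abs_injective h')

/-- Since unbarred symbols occur in increasing and barred symbols in decreasing order, a position
is a descent exactly when its symbol is barred. -/
theorem mem_Des_iff (b : PB n) (i : Fin n) : i ∈ b.Des ↔ (b.1.1 i).2 = true := by
  have hlt := (b.1.1 i).1.isLt
  change ((∃ h : (i : ℕ) + 1 < n, (b.1.1 ⟨i + 1, h⟩).linePos < (b.1.1 i).linePos) ∨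
    ((i : ℕ) + 1 = n ∧ (b.1.1 i).2 = true)) ↔ _
  by_cases h : (i : ℕ) + 1 < n
  · have hj := (b.1.1 ⟨i + 1, h⟩).1.isLt
    have key := b.abs_lt_of_lt (i := i) (j := ⟨i + 1, h⟩) (by simp [Fin.lt_def])
    simp only [h, exists_true_left, h.ne, false_and, or_false]
    unfold SignedSymbol.linePos SignedSymbol.barred SignedSymbol.abs
    generalize b.1.1 i = x at *
    generalize b.1.1 ⟨i + 1, h⟩ = y at *
    obtain ⟨x, _ | _⟩ := x <;> obtain ⟨y, _ | _⟩ := y <;>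
      simp [← Fin.val_fin_lt] at * <;> omega
  · have : (i : ℕ) + 1 = n := by omega
    simp [this]

theorem Des_eq (b : PB n) : b.Des = ↑b.barredPositions := by
  ext i
  simp [mem_Des_iff, mem_barredPositions]

theorem rank_eq (b : PB n) : b.rank = b.barredPositions.card := by
  rw [rank, Des_eq, Set.ncard_coe_finset]

theorem lt_iff {b b' : PB n} : b < b' ↔ b.barredPositions ⊂ b'.barredPositions := by
  change b.Des ⊂ b'.Des ↔ _
  rw [Des_eq, Des_eq, Finset.coe_ssubset]

theorem card_barredValues (b : PB n) : b.barredValues.card = b.barredPositions.card :=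
  Finset.card_image_of_injective _ b.abs_injective

/-- The positions and the absolute values of the barred symbols. -/
def toPair (b : PB n) : EqualCardPair n :=
  ⟨(b.barredPositions, b.barredValues), b.card_barredValues.symm⟩

theorem mem_barredValues_iff (b : PB n) (i : Fin n) :
    (b.1.1 i).1 ∈ b.barredValues ↔ (b.1.1 i).2 = true := by
  rw [← mem_barredPositions, barredValues]
  exact b.abs_injective.mem_finset_image

/-- The positions and values of the barred symbols determine the word, as both the barred and the
unbarred symbols have to be placed in increasing order of absolute values. -/
theorem toPair_injective : Function.Injective (toPair : PB n → EqualCardPair n) := by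
  intro b b' h
  have hS : b.barredPositions = b'.barredPositions := congrArg (fun p => p.1.1) h
  have hT : b.barredValues = b'.barredValues := congrArg (fun p => p.1.2) h
  have hbar : ∀ i, (b.1.1 i).2 = (b'.1.1 i).2 := by
    intro i
    rw [Bool.eq_iff_iff, ← mem_barredPositions, hS, mem_barredPositions]
  have key : ∀ c : Bool, (fun i : {i // (b.1.1 i).2 = c} => (b.1.1 i).1) =
      fun i : {i // (b.1.1 i).2 = c} => (b'.1.1 i).1 := by
    intro c
    have range_eq : ∀ d : PB n, d.barredValues = b.barredValues →
        (∀ i, (b.1.1 i).2 = (d.1.1 i).2) →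
        Set.range (fun i : {i // (b.1.1 i).2 = c} => (d.1.1 i).1) =
          {v | (v ∈ b.barredValues) ↔ c = true} := by
      intro d hd hd'
      ext v
      obtain ⟨i, rfl⟩ := d.1.2.surjective v
      change _ ↔ ((d.1.1 i).1 ∈ b.barredValues ↔ c = true)
      rw [← hd, mem_barredValues_iff, ← Bool.eq_iff_iff, ← hd']
      constructor
      · rintro ⟨j, hj⟩
        have : j.1 = i := d.abs_injective hj
        exact this ▸ j.2
      · intro hi
        exact ⟨⟨i, hi⟩, rfl⟩
    refine (StrictMono.range_inj ?_ ?_).1 ((range_eq b rfl fun _ => rfl).trans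
      (range_eq b' hT.symm hbar).symm)
    · intro i j hij
      exact b.abs_lt_of_lt hij (i.2.trans j.2.symm)
    · intro i j hij
      exact b'.abs_lt_of_lt hij (by rw [← hbar, ← hbar, i.2, j.2])
  apply Subtype.ext
  apply Subtype.ext
  funext i
  exact Prod.ext (congrFun (key _) ⟨i, rfl⟩) (hbar i)

theorem toPair_surjective : Function.Surjective (toPair : PB n → EqualCardPair n) := by
  rintro ⟨⟨S, T⟩, hST⟩
  change S.card = T.card at hST
  have hST' : Sᶜ.card = Tᶜ.card := by rw [Finset.card_compl, Finset.card_compl, hST]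
  let e : S ≃o T := (S.orderIsoOfFin hST).symm.trans (T.orderIsoOfFin rfl)
  let e' : ↥Sᶜ ≃o ↥Tᶜ := (Sᶜ.orderIsoOfFin hST').symm.trans (Tᶜ.orderIsoOfFin rfl)
  let v : Fin n → Fin n := fun i =>
    if h : i ∈ S then e ⟨i, h⟩ else e' ⟨i, Finset.mem_compl.2 h⟩
  have v_mem : ∀ i (h : i ∈ S), v i = e ⟨i, h⟩ := fun i h => dif_pos h
  have v_not_mem : ∀ i (h : i ∉ S), v i = e' ⟨i, Finset.mem_compl.2 h⟩ := fun i h => dif_neg h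
  have v_mem_iff : ∀ i, v i ∈ T ↔ i ∈ S := by
    intro i
    by_cases h : i ∈ S
    · simp [v_mem i h, h]
    · have := (e' ⟨i, Finset.mem_compl.2 h⟩).2
      rw [v_not_mem i h]
      exact iff_of_false (Finset.mem_compl.1 this) h
  have v_mono : ∀ i j, i < j → (i ∈ S ↔ j ∈ S) → v i < v j := by
    intro i j hij h
    by_cases hi : i ∈ S
    · rw [v_mem i hi, v_mem j (h.1 hi)]
      exact e.strictMono hij
    · rw [v_not_mem i hi, v_not_mem j (fun hj => hi (h.2 hj))]
      exact e'.strictMono hij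
  have v_inj : Function.Injective v := by
    intro i j h
    have hiff : i ∈ S ↔ j ∈ S := by rw [← v_mem_iff, ← v_mem_iff, h]
    rcases lt_trichotomy i j with hij | hij | hij
    · exact absurd h (v_mono i j hij hiff).ne
    · exact hij
    · exact absurd h (v_mono j i hij hiff.symm).ne'
  let b : PB n := ⟨⟨fun i => (v i, decide (i ∈ S)), Finite.injective_iff_bijective.1 v_inj⟩, by
    rintro ⟨i, j, hij, h, h'⟩
    have hiff : i ∈ S ↔ j ∈ S := decide_eq_decide.1 h
    exact lt_asymm h' (v_mono i j hij hiff)⟩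
  have hb : b.barredPositions = S := by
    ext i
    rw [mem_barredPositions]
    exact decide_eq_true_iff
  refine ⟨b, Subtype.ext (Prod.ext hb ?_)⟩
  refine Finset.eq_of_subset_of_card_le ?_ ?_
  · intro x hx
    obtain ⟨i, hi, rfl⟩ := Finset.mem_image.1 hx
    exact (v_mem_iff i).2 (hb ▸ hi)
  · change T.card ≤ b.barredValues.card
    rw [card_barredValues, hb, hST]

/-- An element of `PB n` amounts to the set of positions and the set of absolute values of its
barred symbols, which are arbitrary subsets of the same size. -/
noncomputable def pairEquiv (n : ℕ) : PB n ≃ EqualCardPair n :=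
  Equiv.ofBijective toPair ⟨toPair_injective, toPair_surjective⟩

theorem barredPositions_pairEquiv_symm (p : EqualCardPair n) :
    ((pairEquiv n).symm p).barredPositions = p.1.1 :=
  congrArg (fun q => q.1.1) ((pairEquiv n).apply_symm_apply p)

theorem exists_barredPositions_eq (S : Finset (Fin n)) : ∃ b : PB n, b.barredPositions = S :=
  ⟨(pairEquiv n).symm ⟨(S, S), rfl⟩, barredPositions_pairEquiv_symm _⟩

/-! ### Rank sizes and self-duality -/

theorem isRankFunction_rank : IsRankFunction (rank : PB n → ℕ) := by
  constructor
  · intro b hb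
    rw [rank_eq, Finset.card_eq_zero]
    by_contra hne
    obtain ⟨c, hc⟩ := exists_barredPositions_eq (∅ : Finset (Fin n))
    refine hb.not_lt (b := c) (lt_iff.2 ?_)
    rw [hc]
    exact Finset.empty_ssubset.2 (Finset.nonempty_iff_ne_empty.2 hne)
  · intro b b' h
    have hss := lt_iff.1 h.1
    obtain ⟨x, hx', hx⟩ := Finset.exists_of_ssubset hss
    obtain ⟨c, hc⟩ := exists_barredPositions_eq (insert x b.barredPositions)
    have hbc : b < c := lt_iff.2 (hc ▸ Finset.ssubset_insert hx)
    have hcb : ¬ insert x b.barredPositions ⊂ b'.barredPositions :=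
      fun h' => h.2 hbc (lt_iff.2 (hc ▸ h'))
    have hsub : insert x b.barredPositions ⊆ b'.barredPositions :=
      Finset.insert_subset hx' hss.1
    have heq := (eq_or_ssubset_of_subset hsub).resolve_right hcb
    rw [rank_eq, rank_eq, ← heq, Finset.card_insert_of_notMem hx]

theorem rankSize_rank (k : ℕ) : rankSize (rank : PB n → ℕ) k = n.choose k ^ 2 := by
  have hinj : Function.Injective fun b : PB n => (b.barredPositions, b.barredValues) :=
    fun b b' h => toPair_injective (Subtype.ext h)
  rw [rankSize, ← Set.ncard_image_of_injective _ hinj]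
  have : (fun b : PB n => (b.barredPositions, b.barredValues)) '' {b | b.rank = k} =
      ↑(Finset.powersetCard k (Finset.univ : Finset (Fin n)) ×ˢ
        Finset.powersetCard k (Finset.univ : Finset (Fin n))) := by
    ext ⟨S, T⟩
    simp only [Set.mem_image, Set.mem_ofPred_eq, Finset.coe_product, Set.mem_prod, Finset.mem_coe,
      Finset.mem_powersetCard, Finset.subset_univ, true_and, rank_eq]
    constructor
    · rintro ⟨b, hb, h⟩
      obtain ⟨rfl, rfl⟩ := Prod.mk.inj h
      exact ⟨hb, b.card_barredValues.trans hb⟩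
    · rintro ⟨hS, hT⟩
      obtain ⟨b, hb⟩ := toPair_surjective (⟨(S, T), hS.trans hT.symm⟩ : EqualCardPair n)
      have hb' : (b.barredPositions, b.barredValues) = (S, T) := congrArg Subtype.val hb
      exact ⟨b, by rw [(Prod.mk.inj hb').1, hS], hb'⟩
  rw [this, Set.ncard_coe_finset, Finset.card_product, Finset.card_powersetCard, Finset.card_univ,
    Fintype.card_fin, sq]

theorem rank_le (b : PB n) : b.rank ≤ n := by
  rw [rank_eq]
  exact (Finset.card_le_univ _).trans_eq (Fintype.card_fin n)

theorem rankSymmetric_rank : RankSymmetric (rank : PB n → ℕ) := by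
  refine ⟨n, ⟨?_, ?_⟩, fun k hk => ?_⟩
  · obtain ⟨b, hb⟩ := exists_barredPositions_eq (Finset.univ : Finset (Fin n))
    exact ⟨b, by rw [rank_eq, hb, Finset.card_univ, Fintype.card_fin]⟩
  · rintro _ ⟨b, rfl⟩
    exact b.rank_le
  · rw [rankSize_rank, rankSize_rank, Nat.choose_symm hk]

theorem rankUnimodal_rank : RankUnimodal (rank : PB n → ℕ) := by
  refine ⟨n / 2, monotoneOn_of_le_add_one Set.ordConnected_Iic fun k _ _ hk => ?_,
    antitoneOn_of_add_one_le Set.ordConnected_Ici fun k _ hk _ => ?_⟩ <;>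
    rw [rankSize_rank, rankSize_rank] <;> refine Nat.pow_le_pow_left ?_ 2
  · exact Nat.choose_le_succ_of_lt_half_left (Nat.lt_of_succ_le hk)
  · have hk : n / 2 ≤ k := hk
    refine Nat.le_of_mul_le_mul_right (c := k + 1) ?_ k.succ_pos
    rw [Nat.choose_succ_right_eq]
    exact Nat.mul_le_mul_left _ (by omega)

/-- Complementing the positions and the values of the barred symbols reverses the order. -/
theorem selfDual : SelfDual (PB n) := by
  let c : EqualCardPair n ≃ EqualCardPair n :=
    { toFun := fun p => ⟨(p.1.1ᶜ, p.1.2ᶜ), by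
        rw [Finset.card_compl, Finset.card_compl, p.2]⟩
      invFun := fun p => ⟨(p.1.1ᶜ, p.1.2ᶜ), by
        rw [Finset.card_compl, Finset.card_compl, p.2]⟩
      left_inv := fun p => by simp
      right_inv := fun p => by simp }
  let e : PB n ≃ PB n := (pairEquiv n).trans (c.trans (pairEquiv n).symm)
  have he : ∀ b : PB n, (e b).barredPositions = b.barredPositionsᶜ := fun b =>
    barredPositions_pairEquiv_symm _
  have hlt : ∀ b b' : PB n, e b' < e b ↔ b < b' := by
    intro b b'
    rw [lt_iff, lt_iff, he, he, Finset.compl_ssubset_compl]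
  refine ⟨{ toEquiv := e.trans OrderDual.toDual, map_rel_iff' := fun {b b'} => ?_ }⟩
  change e b' ≤ e b ↔ b ≤ b'
  rw [le_iff_lt_or_eq, le_iff_lt_or_eq, hlt, e.injective.eq_iff, eq_comm (a := b)]

/-! ### The strong Sperner property -/

theorem card_filter_barredPositions_eq_le (s : Finset (Fin n)) :
    (Finset.univ.filter fun b : PB n => b.barredPositions = s).card ≤ n.choose s.card := by
  have : (Finset.univ.filter fun b : PB n => b.barredPositions = s).card ≤
      (Finset.powersetCard s.card (Finset.univ : Finset (Fin n))).card := by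
    refine Finset.card_le_card_of_injOn barredValues ?_ ?_
    · intro b hb
      have hb : b.barredPositions = s := (Finset.mem_filter.1 hb).2
      exact Finset.mem_powersetCard.2 ⟨Finset.subset_univ _, by rw [card_barredValues, hb]⟩
    · intro b hb b' hb' h
      have hb : b.barredPositions = s := (Finset.mem_filter.1 hb).2
      have hb' : b'.barredPositions = s := (Finset.mem_filter.1 hb').2
      exact toPair_injective (Subtype.ext (Prod.ext (hb.trans hb'.symm) h))
  rwa [Finset.card_powersetCard, Finset.card_univ, Fintype.card_fin] at this

end PB

theorem sum_biUnion_le_sum_sum {ι α : Type*} [DecidableEq α] (u : Finset ι) (t : ι → Finset α)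
    {f : α → ℚ} (hf : ∀ a, 0 ≤ f a) : ∑ a ∈ u.biUnion t, f a ≤ ∑ i ∈ u, ∑ a ∈ t i, f a := by
  classical
  induction u using Finset.induction_on with
  | empty => simp
  | insert i u hi ih =>
    rw [Finset.biUnion_insert, Finset.sum_insert hi]
    have h := Finset.sum_union_inter (s₁ := t i) (s₂ := u.biUnion t) (f := f)
    have h' : 0 ≤ ∑ a ∈ t i ∩ u.biUnion t, f a := Finset.sum_nonneg fun a _ => hf a
    linarith

/-- A fractional knapsack bound: if `K` has the largest total weight among the sets of `k` indices,
then no choice of fractions `x j ≤ 1` of total at most `k` has a larger weight. -/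
theorem sum_mul_le_sum_of_maximal (W : ℕ → ℕ) (K J : Finset ℕ)
    (hK : ∀ K' : Finset ℕ, K'.card = K.card → ∑ i ∈ K', W i ≤ ∑ i ∈ K, W i)
    (x : ℕ → ℚ) (hx0 : ∀ j, 0 ≤ x j) (hx1 : ∀ j, x j ≤ 1) (hx : ∑ j ∈ J, x j ≤ K.card) :
    ∑ j ∈ J, x j * W j ≤ ∑ i ∈ K, (W i : ℚ) := by
  -- A threshold `t` separates the weights inside `K` from those outside.
  obtain ⟨t, htK, htJ⟩ : ∃ t : ℕ, (∀ i ∈ K, t ≤ W i) ∧ ∀ j ∈ J, j ∉ K → W j ≤ t := by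
    rcases K.eq_empty_or_nonempty with rfl | hne
    · exact ⟨J.sup W, by simp, fun j hj _ => Finset.le_sup hj⟩
    · obtain ⟨i, hi, hmin⟩ := K.exists_min_image W hne
      refine ⟨W i, hmin, fun j _ hjK => ?_⟩
      have hji : j ∉ K.erase i := fun h => hjK (Finset.mem_of_mem_erase h)
      have h := hK (insert j (K.erase i)) (by
        rw [Finset.card_insert_of_notMem hji, Finset.card_erase_add_one hi])
      rw [Finset.sum_insert hji, ← Finset.add_sum_erase K W hi] at h
      omega
  have h1 : ∑ j ∈ J, x j * ((W j : ℚ) - t) ≤ ∑ i ∈ K, ((W i : ℚ) - t) := by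
    have hpos : ∀ i ∈ K, (0 : ℚ) ≤ (W i : ℚ) - t := fun i hi =>
      sub_nonneg.2 (by exact_mod_cast htK i hi)
    calc ∑ j ∈ J, x j * ((W j : ℚ) - t)
        ≤ ∑ j ∈ J, if j ∈ K then (W j : ℚ) - t else 0 := by
          refine Finset.sum_le_sum fun j hj => ?_
          split_ifs with h
          · exact mul_le_of_le_one_left (hpos j h) (hx1 j)
          · exact mul_nonpos_of_nonneg_of_nonpos (hx0 j)
              (sub_nonpos.2 (by exact_mod_cast htJ j hj h))
      _ = ∑ j ∈ J.filter (· ∈ K), ((W j : ℚ) - t) := (Finset.sum_filter _ _).symm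
      _ ≤ ∑ i ∈ K, ((W i : ℚ) - t) :=
          Finset.sum_le_sum_of_subset_of_nonneg (fun j hj => (Finset.mem_filter.1 hj).2)
            fun i hi _ => hpos i hi
  simp only [mul_sub, Finset.sum_sub_distrib, ← Finset.sum_mul, Finset.sum_const,
    nsmul_eq_mul] at h1
  have h2 : (∑ j ∈ J, x j) * (t : ℚ) ≤ (K.card : ℚ) * t :=
    mul_le_mul_of_nonneg_right hx (Nat.cast_nonneg t)
  linarith

namespace PB

variable {n : ℕ}

/-- A union of `k` antichains of `PB n` projects to a union of `k` antichains of subsets, each of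
which satisfies the Lubell–Yamamoto–Meshalkin inequality; each subset `s` has `n.choose s.card`
elements of `PB n` above it. -/
theorem ncard_iUnion_antichain_le {k : ℕ} (A : Fin k → Set (PB n))
    (hA : ∀ i, IsAntichain (· ≤ ·) (A i)) (K : Finset ℕ) (hKk : K.card = k)
    (hK : ∀ K' : Finset ℕ, K'.card = K.card →
      ∑ i ∈ K', rankSize (rank : PB n → ℕ) i ≤ ∑ i ∈ K, rankSize (rank : PB n → ℕ) i) :
    (⋃ i, A i).ncard ≤ ∑ i ∈ K, rankSize (rank : PB n → ℕ) i := by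
  classical
  let G : Fin k → Finset (Finset (Fin n)) := fun i =>
    (Finset.univ.filter (· ∈ A i)).image barredPositions
  let F : Finset (Finset (Fin n)) := Finset.univ.biUnion G
  have hcast : ∀ s : Finset (Fin n), (0 : ℚ) < n.choose s.card := fun s => by
    exact_mod_cast Nat.choose_pos ((Finset.card_le_univ s).trans_eq (Fintype.card_fin n))
  have hU : (⋃ i, A i).ncard ≤ ∑ s ∈ F, n.choose s.card := by
    have hsub : (⋃ i, A i) ⊆ ↑(F.biUnion fun s =>
        Finset.univ.filter fun b : PB n => b.barredPositions = s) := by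
      intro b hb
      obtain ⟨i, hi⟩ := Set.mem_iUnion.1 hb
      simp only [Finset.coe_biUnion, Set.mem_iUnion, Finset.mem_coe, Finset.mem_filter,
        Finset.mem_univ, true_and]
      exact ⟨_, Finset.mem_biUnion.2 ⟨i, Finset.mem_univ _,
        Finset.mem_image_of_mem _ (by simpa using hi)⟩, rfl⟩
    calc (⋃ i, A i).ncard ≤ _ := Set.ncard_le_ncard hsub (Finset.finite_toSet _)
      _ ≤ _ := by
        rw [Set.ncard_coe_finset]
        exact Finset.card_biUnion_le.trans
          (Finset.sum_le_sum fun s _ => card_filter_barredPositions_eq_le s)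
  have hG : ∀ i, ∑ s ∈ G i, ((n.choose s.card : ℚ))⁻¹ ≤ 1 := by
    intro i
    have hanti : IsAntichain (· ⊆ ·) (G i : Set (Finset (Fin n))) := by
      intro s hs t ht hne hst
      obtain ⟨b, hb, rfl⟩ := Finset.mem_image.1 hs
      obtain ⟨c, hc, rfl⟩ := Finset.mem_image.1 ht
      have hb : b ∈ A i := by simpa using hb
      have hc : c ∈ A i := by simpa using hc
      have hlt : b < c := lt_iff.2 (lt_of_le_of_ne hst hne)
      exact hA i hb hc hlt.ne hlt.le
    have h := Finset.lubell_yamamoto_meshalkin_inequality_sum_inv_choose (𝕜 := ℚ) hanti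
    rwa [Fintype.card_fin] at h
  have hF : ∑ s ∈ F, ((n.choose s.card : ℚ))⁻¹ ≤ k := by
    calc ∑ s ∈ F, ((n.choose s.card : ℚ))⁻¹
        ≤ ∑ i, ∑ s ∈ G i, ((n.choose s.card : ℚ))⁻¹ := by
          exact sum_biUnion_le_sum_sum _ _ fun s => (inv_pos.2 (hcast s)).le
      _ ≤ ∑ _i : Fin k, (1 : ℚ) := Finset.sum_le_sum fun i _ => hG i
      _ = k := by simp
  let x : ℕ → ℚ := fun j => ((F.filter fun s => s.card = j).card : ℚ) / n.choose j
  have hmaps : ∀ s ∈ F, s.card ∈ Finset.range (n + 1) := fun s _ =>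
    Finset.mem_range.2 (Nat.lt_succ_of_le ((Finset.card_le_univ s).trans_eq (Fintype.card_fin n)))
  have hsum : ∀ g : ℕ → ℚ, ∑ s ∈ F, g s.card =
      ∑ j ∈ Finset.range (n + 1), ((F.filter fun s => s.card = j).card : ℚ) * g j := by
    intro g
    rw [← Finset.sum_fiberwise_of_maps_to' hmaps]
    simp
  have hx1 : ∀ j, x j ≤ 1 := by
    intro j
    refine div_le_one_of_le₀ ?_ (Nat.cast_nonneg _)
    have : (F.filter fun s => s.card = j) ⊆ Finset.powersetCard j Finset.univ := by
      intro s hs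
      exact Finset.mem_powersetCard.2 ⟨Finset.subset_univ _, (Finset.mem_filter.1 hs).2⟩
    have h := Finset.card_le_card this
    rw [Finset.card_powersetCard, Finset.card_univ, Fintype.card_fin] at h
    exact_mod_cast h
  have hx : ∑ j ∈ Finset.range (n + 1), x j ≤ K.card := by
    rw [hKk]
    refine le_trans (le_of_eq ?_) hF
    rw [hsum fun j => ((n.choose j : ℚ))⁻¹]
    rfl
  have hmain := sum_mul_le_sum_of_maximal _ K (Finset.range (n + 1)) hK x
    (fun j => by positivity) hx1 hx
  have hxW : ∑ j ∈ Finset.range (n + 1), x j * (rankSize (rank : PB n → ℕ) j : ℚ) =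
      ∑ s ∈ F, (n.choose s.card : ℚ) := by
    rw [hsum fun j => (n.choose j : ℚ)]
    refine Finset.sum_congr rfl fun j hj => ?_
    have hj : (n.choose j : ℚ) ≠ 0 := by
      exact_mod_cast (Nat.choose_pos (Nat.lt_succ_iff.1 (Finset.mem_range.1 hj))).ne'
    rw [rankSize_rank]
    simp only [x]
    push_cast
    field_simp
  rw [hxW] at hmain
  exact hU.trans (by exact_mod_cast hmain)

theorem exists_iUnion_antichain_ncard_eq {k : ℕ} (K : Finset ℕ) (hKk : K.card = k) :
    ∃ A : Fin k → Set (PB n), (∀ i, IsAntichain (· ≤ ·) (A i)) ∧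
      (⋃ i, A i).ncard = ∑ i ∈ K, rankSize (rank : PB n → ℕ) i := by
  classical
  let e := K.equivFinOfCardEq hKk
  refine ⟨fun i => {b | b.rank = e.symm i}, fun i => ?_, ?_⟩
  · intro b hb c hc hne hbc
    have hlt := Finset.card_lt_card (lt_iff.1 (lt_of_le_of_ne hbc hne))
    rw [← rank_eq, ← rank_eq, show b.rank = _ from hb, show c.rank = _ from hc] at hlt
    exact lt_irrefl _ hlt
  · have : (⋃ i, {b : PB n | b.rank = e.symm i}) =
        ↑(K.biUnion fun j => Finset.univ.filter fun b : PB n => b.rank = j) := by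
      ext b
      simp only [Set.mem_iUnion, Set.mem_ofPred_eq, Finset.coe_biUnion, Finset.mem_coe,
        Finset.mem_filter, Finset.mem_univ, true_and]
      constructor
      · rintro ⟨i, hi⟩
        exact ⟨_, (e.symm i).2, hi⟩
      · rintro ⟨j, hj, h⟩
        exact ⟨e ⟨j, hj⟩, by simpa using h⟩
    rw [this, Set.ncard_coe_finset, Finset.card_biUnion]
    · refine Finset.sum_congr rfl fun j _ => ?_
      rw [rankSize, ← Set.ncard_coe_finset]
      simp
    · intro i _ j _ hij
      exact Finset.disjoint_filter.2 fun b _ hb hb' => hij (hb.symm.trans hb')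

theorem stronglySperner_rank : StronglySperner (rank : PB n → ℕ) := by
  intro k
  let V : Set ℕ := {s | ∃ K : Finset ℕ, K.card = k ∧ ∑ i ∈ K, rankSize (rank : PB n → ℕ) i = s}
  have hne : V.Nonempty := ⟨_, Finset.range k, Finset.card_range k, rfl⟩
  have hbdd : BddAbove V := by
    refine ⟨∑ i ∈ Finset.range (n + 1), rankSize (rank : PB n → ℕ) i, ?_⟩
    rintro _ ⟨K, _, rfl⟩
    refine Finset.sum_le_sum_of_ne_zero fun i _ hi => ?_
    by_contra h
    refine hi ?_
    rw [rankSize_rank, Nat.choose_eq_zero_of_lt (by simpa using h)]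
    rfl
  obtain ⟨K, hKk, hKs⟩ := Nat.sSup_mem hne hbdd
  have hmax : ∀ K' : Finset ℕ, K'.card = K.card →
      ∑ i ∈ K', rankSize (rank : PB n → ℕ) i ≤ ∑ i ∈ K, rankSize (rank : PB n → ℕ) i :=
    fun K' hK' => (le_csSup hbdd ⟨K', hK'.trans hKk, rfl⟩).trans_eq hKs.symm
  refine ⟨sSup V, ⟨?_, ?_⟩, ⟨⟨K, hKk, hKs⟩, fun _ h => le_csSup hbdd h⟩⟩
  · obtain ⟨A, hA, h⟩ := exists_iUnion_antichain_ncard_eq (n := n) K hKk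
    exact ⟨A, hA, h.trans hKs⟩
  · rintro _ ⟨A, hA, rfl⟩
    exact (ncard_iUnion_antichain_le A hA K hKk hmax).trans_eq hKs

end PB

/-! ### Noncrossing equivalence relations on a circle, unrolled to the integers -/

/-- A noncrossing equivalence relation on `2 * n` points of a circle, unrolled to a periodic
relation on `ℤ`: the points of the circle are the integers modulo `2 * n`. -/
structure IsNoncrossingRel (n : ℤ) (r : ℤ → ℤ → Prop) : Prop where
  refl : ∀ i, r i i
  symm : ∀ {i j}, r i j → r j i
  trans : ∀ {i j k}, r i j → r j k → r i k
  period : ∀ i, r i (i + 2 * n)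
  noncrossing : ∀ {i j k l}, i < j → j < k → k < l → l < i + 2 * n → r i k → r j l → r i j

/-- A noncrossing relation that is invariant under the half turn `i ↦ i + n`, which unrolls the bar
involution. -/
structure IsTypeBRel (n : ℤ) (r : ℤ → ℤ → Prop) : Prop extends IsNoncrossingRel n r where
  shift : ∀ {i j}, r i j → r (i + n) (j + n)

/-- `a` is an opener if it is related to none of the `n` integers preceding it. For a type-B
relation this means that `a` is the clockwise first element of a non-zero block. -/
def IsOpener (n : ℤ) (r : ℤ → ℤ → Prop) (a : ℤ) : Prop :=
  ∀ b, a - n ≤ b → b < a → ¬ r b a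

/-- `a` is a closer if it is related to none of the `n` integers following it. For a type-B
relation this means that `a` is the clockwise last element of a non-zero block. -/
def IsCloser (n : ℤ) (r : ℤ → ℤ → Prop) (a : ℤ) : Prop :=
  ∀ b, a < b → b ≤ a + n → ¬ r a b

namespace IsNoncrossingRel

variable {n : ℤ} {r : ℤ → ℤ → Prop}

theorem period_mul (h : IsNoncrossingRel n r) (i t : ℤ) : r i (i + 2 * n * t) := by
  induction t using Int.induction_on with
  | zero => simpa using h.refl i
  | succ t ih =>
    have := h.trans ih (h.period _)
    rwa [show i + 2 * n * t + 2 * n = i + 2 * n * (t + 1) by ring] at this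
  | pred t ih =>
    have := h.period (i + 2 * n * (-t - 1))
    rw [show i + 2 * n * (-t - 1) + 2 * n = i + 2 * n * -t by ring] at this
    exact h.trans ih (h.symm this)

theorem congr_add (h : IsNoncrossingRel n r) {i j : ℤ} : r (i + 2 * n) (j + 2 * n) ↔ r i j :=
  ⟨fun hr => h.trans (h.period i) (h.trans hr (h.symm (h.period j))),
    fun hr => h.trans (h.symm (h.period i)) (h.trans hr (h.period j))⟩

theorem reflect (h : IsNoncrossingRel n r) : IsNoncrossingRel n fun i j => r (-i) (-j) where
  refl i := h.refl _
  symm hr := h.symm hr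
  trans hr hr' := h.trans hr hr'
  period i := by
    have := h.period (-(i + 2 * n))
    rw [show -(i + 2 * n) + 2 * n = -i by ring] at this
    exact h.symm this
  noncrossing {i j k l} hij hjk hkl hl hik hjl := by
    have h1 := h.noncrossing (i := -l) (j := -k) (k := -j) (l := -i) (by omega) (by omega)
      (by omega) (by omega) (h.symm hjl) (h.symm hik)
    exact h.trans hik (h.trans (h.symm h1) (h.symm hjl))

end IsNoncrossingRel

namespace IsTypeBRel

variable {n : ℤ} {r r' : ℤ → ℤ → Prop}

theorem shift_iff (h : IsTypeBRel n r) {i j : ℤ} : r (i + n) (j + n) ↔ r i j := by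
  refine ⟨fun hr => ?_, h.shift⟩
  have := h.shift hr
  rwa [add_assoc, add_assoc, ← two_mul, h.congr_add] at this

theorem reflect (h : IsTypeBRel n r) : IsTypeBRel n fun i j => r (-i) (-j) where
  toIsNoncrossingRel := h.toIsNoncrossingRel.reflect
  shift {i j} hr := by
    rw [← h.shift_iff]
    simpa using hr

/-! ### Openers and closers -/

theorem isOpener_reflect_iff (h : IsTypeBRel n r) {a : ℤ} :
    IsOpener n (fun i j => r (-i) (-j)) (-a) ↔ IsCloser n r a := by
  constructor
  · intro ha b hab hb hr
    refine ha (-b) (by omega) (by omega) ?_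
    simpa only [neg_neg] using h.symm hr
  · intro ha b hb hba hr
    rw [neg_neg] at hr
    exact ha (-b) (by omega) (by omega) (h.symm hr)

theorem isOpener_add_iff (h : IsTypeBRel n r) {a : ℤ} :
    IsOpener n r (a + n) ↔ IsOpener n r a := by
  constructor
  · intro ha b hb hba hr
    exact ha (b + n) (by omega) (by omega) (h.shift hr)
  · intro ha b hb hba hr
    refine ha (b - n) (by omega) (by omega) (h.shift_iff.1 ?_)
    rwa [sub_add_cancel]

theorem isCloser_add_iff (h : IsTypeBRel n r) {a : ℤ} :
    IsCloser n r (a + n) ↔ IsCloser n r a := by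
  constructor
  · intro ha b hb hba hr
    exact ha (b + n) (by omega) (by omega) (h.shift hr)
  · intro ha b hb hba hr
    refine ha (b - n) (by omega) (by omega) (h.shift_iff.1 ?_)
    rwa [sub_add_cancel]

theorem not_rel_add_of_isOpener (h : IsTypeBRel n r) (hn : 0 < n) {a : ℤ} (ha : IsOpener n r a) :
    ¬ r a (a + n) := by
  intro hr
  refine ha (a - n) le_rfl (by omega) (h.shift_iff.1 ?_)
  rwa [sub_add_cancel]

theorem not_rel_add_of_isCloser (hn : 0 < n) {a : ℤ} (ha : IsCloser n r a) :
    ¬ r a (a + n) :=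
  ha (a + n) (by omega) le_rfl

/-- A block contains at most one opener. -/
theorem not_rel_of_isOpener (h : IsTypeBRel n r) {a b : ℤ} (hab : a < b) (hb : b < a + 2 * n)
    (hoa : IsOpener n r a) (hob : IsOpener n r b) : ¬ r a b := by
  intro hr
  by_cases hd : b - n ≤ a
  · exact hob a hd hab hr
  · refine hoa (b - 2 * n) (by omega) (by omega) ?_
    have := h.period (b - 2 * n)
    rw [sub_add_cancel] at this
    exact h.trans this (h.symm hr)

theorem not_rel_of_isCloser (h : IsTypeBRel n r) {a b : ℤ} (hab : a < b) (hb : b < a + 2 * n)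
    (hca : IsCloser n r a) (hcb : IsCloser n r b) : ¬ r a b := by
  intro hr
  refine h.reflect.not_rel_of_isOpener (a := -b) (b := -a) (by omega) (by omega)
    (h.isOpener_reflect_iff.2 hcb) (h.isOpener_reflect_iff.2 hca) ?_
  rw [neg_neg, neg_neg]
  exact h.symm hr

/-- Every non-zero block contains an opener. -/
theorem exists_isOpener (h : IsTypeBRel n r) (hn : 0 < n) {x : ℤ} (hx : ¬ r x (x + n)) :
    ∃ a, IsOpener n r a ∧ r a x := by
  obtain ⟨a, ⟨hxa, hax⟩, hmin⟩ := Int.exists_least_of_bdd (P := fun z => x - n < z ∧ r z x)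
    ⟨x - n, fun z hz => hz.1.le⟩ ⟨x, by omega, h.refl x⟩
  have hle := hmin x ⟨by omega, h.refl x⟩
  refine ⟨a, fun b hb hba hr => hx ?_, hax⟩
  have hbx : b ≤ x - n := by
    by_contra hc
    have := hmin b ⟨by omega, h.trans hr hax⟩
    omega
  -- Now `a ≤ b + n ≤ x`, and the half turn maps the block of `a` and `x` to that of `b + n`.
  have hbn : r (b + n) (x + n) := h.shift (h.trans hr hax)
  rcases eq_or_lt_of_le (show b ≤ x - n from hbx) with rfl | hlt
  · rwa [sub_add_cancel] at hbn
  · rcases eq_or_lt_of_le (show a ≤ b + n by omega) with heq | hlt'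
    · rw [← heq] at hbn
      exact h.trans (h.symm hax) hbn
    · have := h.noncrossing hlt' (by omega) (by omega : x < x + n) (by omega) hax hbn
      exact h.trans (h.symm hax) (h.trans this hbn)

theorem exists_isCloser (h : IsTypeBRel n r) (hn : 0 < n) {x : ℤ} (hx : ¬ r x (x + n)) :
    ∃ a, IsCloser n r a ∧ r a x := by
  obtain ⟨a, ha, hr⟩ := h.reflect.exists_isOpener hn (x := -x) fun hr => hx (by
    have := h.shift_iff.2 hr
    rw [neg_neg, neg_add_rev, neg_neg, add_comm (-n), neg_add_cancel_right] at this
    exact h.symm this)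
  rw [neg_neg] at hr
  exact ⟨-a, h.isOpener_reflect_iff.1 (by rwa [neg_neg]), hr⟩

/-- If two type-B relations have the same openers and closers and agree at all distances below `d`,
then they agree at distance `d`. In the crucial case, `i` has an `r'`-relative beyond `i + d`, and
`i + d` has one before `i`, so that their `r'`-blocks would cross if they were different. -/
theorem rel_of_agree (h : IsTypeBRel n r) (h' : IsTypeBRel n r')
    (ho : ∀ a, IsOpener n r' a → IsOpener n r a) (hc : ∀ a, IsCloser n r' a → IsCloser n r a)
    {d : ℤ} (hd : 0 < d) (hdn : d ≤ n)
    (hagree : ∀ i j, i < j → j < i + d → (r i j ↔ r' i j)) {i : ℤ} (hr : r i (i + d)) :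
    r' i (i + d) := by
  by_cases hmid : ∃ c, i < c ∧ c < i + d ∧ r i c
  · obtain ⟨c, hic, hci, hrc⟩ := hmid
    exact h'.trans ((hagree i c hic hci).1 hrc)
      ((hagree c (i + d) hci (by omega)).1 (h.trans (h.symm hrc) hr))
  · have hnc : ¬ IsCloser n r' i := fun hcl => hc i hcl (i + d) (by omega) (by omega) hr
    have hno : ¬ IsOpener n r' (i + d) := fun hop =>
      ho (i + d) hop i (by omega) (by omega) hr
    simp only [IsCloser, IsOpener, not_forall, not_not] at hnc hno
    obtain ⟨j', hij', hj', hrj⟩ := hnc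
    obtain ⟨i', hi', hii', hri⟩ := hno
    rcases lt_trichotomy j' (i + d) with hlt | rfl | hgt
    · exact absurd ⟨j', hij', hlt, (hagree i j' hij' hlt).2 hrj⟩ hmid
    · exact hrj
    · rcases lt_trichotomy i' i with hlt' | rfl | hgt'
      · have := h'.noncrossing hlt' (by omega : i < i + d) hgt (by omega) hri hrj
        exact h'.trans (h'.symm this) hri
      · exact hri
      · have := (hagree i' (i + d) hii' (by omega)).2 hri
        exact absurd ⟨i', hgt', hii', h.trans hr (h.symm this)⟩ hmid

/-- A type-B relation is determined by its openers and closers. -/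
theorem rel_iff_rel (h : IsTypeBRel n r) (h' : IsTypeBRel n r')
    (ho : ∀ a, IsOpener n r a ↔ IsOpener n r' a) (hc : ∀ a, IsCloser n r a ↔ IsCloser n r' a)
    {i j : ℤ} (hij : i < j) (hj : j < i + 2 * n) : r i j ↔ r' i j := by
  have key : ∀ d : ℕ, (d : ℤ) ≤ n → ∀ i j : ℤ, i < j → j ≤ i + d → (r i j ↔ r' i j) := by
    intro d
    induction d with
    | zero =>
      intro _ i j hij hj
      omega
    | succ d ih =>
      intro hd i j hij hj
      push_cast at hd hj
      have ih' : ∀ i j : ℤ, i < j → j < i + (d + 1 : ℤ) → (r i j ↔ r' i j) :=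
        fun i j hij hj => ih (by omega) i j hij (by omega)
      rcases eq_or_lt_of_le hj with rfl | hlt
      · exact ⟨h.rel_of_agree h' (fun a => (ho a).2) (fun a => (hc a).2) (by omega) hd ih',
          h'.rel_of_agree h (fun a => (ho a).1) (fun a => (hc a).1) (by omega) hd
            fun i j hij hj => (ih' i j hij hj).symm⟩
      · exact ih' i j hij hlt
  have hn : (n.toNat : ℤ) = n := Int.toNat_of_nonneg (by omega)
  by_cases hd : j ≤ i + n
  · exact key n.toNat hn.le i j hij (by omega)
  · have hk := key n.toNat hn.le j (i + 2 * n) hj (by omega)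
    constructor
    · intro hr
      exact h'.trans (h'.period i) (h'.symm (hk.1 (h.trans (h.symm hr) (h.period i))))
    · intro hr
      exact h.trans (h.period i) (h.symm (hk.2 (h'.trans (h'.symm hr) (h'.period i))))

end IsTypeBRel

/-! ### Merging two neighbouring blocks -/

/-- The relation obtained from `r` by merging the blocks of `a` and `b`. -/
def mergeRel {α : Type*} (r : α → α → Prop) (a b : α) (x y : α) : Prop :=
  r x y ∨ ((r x a ∨ r x b) ∧ (r y a ∨ r y b))

theorem mergeRel_equivalence {α : Type*} {r : α → α → Prop} (h : Equivalence r) (a b : α) :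
    Equivalence (mergeRel r a b) where
  refl x := Or.inl (h.refl x)
  symm := by
    rintro x y (hr | ⟨hx, hy⟩)
    · exact Or.inl (h.symm hr)
    · exact Or.inr ⟨hy, hx⟩
  trans := by
    rintro x y z (hr | ⟨hx, hy⟩) (hr' | ⟨hy', hz⟩)
    · exact Or.inl (h.trans hr hr')
    · exact Or.inr ⟨hy'.imp (h.trans hr) (h.trans hr), hz⟩
    · exact Or.inr ⟨hx, hy.imp (h.trans (h.symm hr')) (h.trans (h.symm hr'))⟩
    · exact Or.inr ⟨hx, hz⟩

theorem mergeRel_le {α : Type*} {r r' : α → α → Prop} (h' : Equivalence r')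
    (hle : ∀ {x y}, r x y → r' x y) {a b : α} (hab : r' a b) {x y : α} (h : mergeRel r a b x y) :
    r' x y := by
  have key : ∀ {z}, r z a ∨ r z b → r' z b := by
    rintro z (hz | hz)
    · exact h'.trans (hle hz) hab
    · exact hle hz
  rcases h with h | ⟨hx, hy⟩
  · exact hle h
  · exact h'.trans (key hx) (h'.symm (key hy))

open Classical in
theorem card_quotient_le_of_mergeRel {α : Type*} [Finite α] {s s' : Setoid α} {a b : α}
    (h : ∀ x y, s' x y → mergeRel s a b x y) :
    Nat.card (Quotient s) ≤ Nat.card (Quotient s') + 1 := by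
  let g : Quotient s → Option (Quotient s') := fun q =>
    if s q.out a then none else some (Quotient.mk s' q.out)
  have hinj : Function.Injective g := by
    intro p q hpq
    rw [← p.out_eq, ← q.out_eq]
    refine Quotient.sound ?_
    by_cases hp : s p.out a <;> by_cases hq : s q.out a
    · exact s.trans hp (s.symm hq)
    · simp [g, hp, hq] at hpq
    · simp [g, hp, hq] at hpq
    · simp only [g, hp, hq, if_false, Option.some.injEq] at hpq
      rcases h _ _ (Quotient.exact hpq) with hr | ⟨h1, h2⟩
      · exact hr
      · exact s.trans (h1.resolve_left hp) (s.symm (h2.resolve_left hq))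
  have := Nat.card_le_card_of_injective _ hinj
  rwa [Finite.card_option] at this

namespace IsNoncrossingRel

variable {n : ℤ} {r r' : ℤ → ℤ → Prop}

theorem equivalence (h : IsNoncrossingRel n r) : Equivalence r :=
  ⟨h.refl, h.symm, h.trans⟩

/-- If `a` and `b` are neighbours in a block of a coarser noncrossing relation, then a block of `r`
that separates two elements of the blocks of `a` and `b` is one of these two blocks: it cannot
separate `a` from `b`, as no element of its `r'`-block lies between them. -/
theorem rel_of_separates (h : IsNoncrossingRel n r) (h' : IsNoncrossingRel n r')
    (hle : ∀ {x y}, r x y → r' x y) {a b : ℤ} (hab : a < b) (hb : b < a + 2 * n) (hrab : r' a b)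
    (hadj : ∀ c, a < c → c < b → ¬ r' c b) {j k l w : ℤ} (hjk : j < k) (hkl : k < l) (hlw : l < w)
    (hw : w < j + 2 * n) (hjl : r j l) (hk : r k a ∨ r k b) (hwab : r w a ∨ r w b) :
    r j a ∨ r j b := by
  by_contra hj
  obtain ⟨hja, hjb⟩ := not_or.1 hj
  have hkw : r' k w := mergeRel_le h'.equivalence hle hrab (Or.inr ⟨hk, hwab⟩)
  have hjk' : r' j k := h'.noncrossing hjk hkl hlw hw (hle hjl) hkw
  have hjb' : r' j b := h'.trans hjk' (mergeRel_le h'.equivalence hle hrab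
    (Or.inr ⟨hk, Or.inr (h.refl b)⟩))
  -- Translate `a` and `b` by a multiple of the period, so that `a` lies between `j` and
  -- `j + 2 * n`.
  obtain ⟨a₁, b₁, hja₁, ha₁, hab₁, haa₁, hbb₁, hadj₁⟩ : ∃ a₁ b₁ : ℤ, j ≤ a₁ ∧ a₁ < j + 2 * n ∧
      a₁ < b₁ ∧ r a a₁ ∧ r b b₁ ∧ ∀ c, a₁ < c → c < b₁ → ¬ r' c b := by
    have hpos : 0 < 2 * n := by omega
    have h1 := Int.emod_nonneg (a - j) hpos.ne'
    have h2 := Int.emod_lt_of_pos (a - j) hpos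
    have h3 := Int.emod_add_mul_ediv (a - j) (2 * n)
    generalize (a - j) / (2 * n) = t at h3
    refine ⟨a + 2 * n * -t, b + 2 * n * -t, ?_, ?_, by omega, h.period_mul _ _,
      h.period_mul _ _, ?_⟩
    · rw [mul_neg]
      omega
    · rw [mul_neg]
      omega
    · intro c hac hcb hr
      rw [mul_neg] at hac hcb
      exact hadj (c + 2 * n * t) (by omega) (by omega) (h'.trans (h'.symm (h'.period_mul c t)) hr)
  have hja₁' : a₁ ≠ j := fun he => hja (by rw [← he]; exact h.symm haa₁)
  have hla₁ : a₁ ≠ l := fun he => hja (h.trans hjl (by rw [← he]; exact h.symm haa₁))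
  have hlb₁ : b₁ ≠ l := fun he => hjb (h.trans hjl (by rw [← he]; exact h.symm hbb₁))
  have hjb₁ : b₁ ≠ j + 2 * n := fun he =>
    hjb (h.trans (h.period j) (by rw [← he]; exact h.symm hbb₁))
  have hl : ¬ (a₁ < l ∧ l < b₁) := fun hc =>
    hadj₁ l hc.1 hc.2 (h'.trans (h'.symm (hle hjl)) hjb')
  have hj2 : ¬ (a₁ < j + 2 * n ∧ j + 2 * n < b₁) := fun hc =>
    hadj₁ _ hc.1 hc.2 (h'.trans (h'.symm (h'.period j)) hjb')
  rcases lt_or_gt_of_ne hla₁ with hlt | hgt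
  · rcases hwab with hwa | hwb
    · exact hja (h.trans (h.noncrossing (j := a₁) (by omega) hlt hlw hw hjl
        (h.symm (h.trans hwa haa₁))) (h.symm haa₁))
    · exact hjb (h.trans (h.noncrossing (j := b₁) (by omega) (by omega) hlw hw hjl
        (h.symm (h.trans hwb hbb₁))) (h.symm hbb₁))
  · rcases hk with hka | hkb
    · exact hja (h.trans (h.noncrossing hjk hkl hgt ha₁ hjl (h.trans hka haa₁)) hka)
    · exact hjb (h.trans (h.noncrossing hjk hkl (l := b₁) (by omega) (by omega) hjl
        (h.trans hkb hbb₁)) hkb)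

/-- Merging the blocks of two neighbours in a block of a coarser noncrossing relation preserves
noncrossingness. -/
theorem mergeRel (h : IsNoncrossingRel n r) (h' : IsNoncrossingRel n r')
    (hle : ∀ {x y}, r x y → r' x y) {a b : ℤ} (hab : a < b) (hb : b < a + 2 * n) (hrab : r' a b)
    (hadj : ∀ c, a < c → c < b → ¬ r' c b) : IsNoncrossingRel n (mergeRel r a b) where
  refl := (mergeRel_equivalence h.equivalence a b).refl
  symm := (mergeRel_equivalence h.equivalence a b).symm
  trans := (mergeRel_equivalence h.equivalence a b).trans
  period i := Or.inl (h.period i)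
  noncrossing := by
    intro i j k l hij hjk hkl hl hik hjl
    rcases hik with hik | ⟨hi, hk⟩
    · rcases hjl with hjl | ⟨hj, hl'⟩
      · exact Or.inl (h.noncrossing hij hjk hkl hl hik hjl)
      · exact Or.inr ⟨h.rel_of_separates h' hle hab hb hrab hadj hij hjk hkl hl hik hj hl', hj⟩
    · rcases hjl with hjl | ⟨hj, _⟩
      · have hp := h.symm (h.period i)
        exact Or.inr ⟨hi, h.rel_of_separates h' hle hab hb hrab hadj hjk hkl hl (by omega) hjl hk
          (hi.imp (h.trans hp) (h.trans hp))⟩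
      · exact Or.inr ⟨hi, hj⟩

end IsNoncrossingRel

/-! ### The relation with prescribed openers and closers -/

/-- The heights of a periodic parenthesis word, in which every integer may be preceded by an opening
and followed by a closing parenthesis: `D i` is the height at `i`, and `M i` the height between `i`
and `i + 1`. -/
structure IsHeight (n : ℤ) (D M : ℤ → ℤ) : Prop where
  periodD : ∀ i, D (i + n) = D i
  periodM : ∀ i, M (i + n) = M i
  le_left : ∀ i, M i ≤ D i
  left_le : ∀ i, D i ≤ M i + 1
  le_right : ∀ i, M (i - 1) ≤ D i
  right_le : ∀ i, D i ≤ M (i - 1) + 1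

/-- `i` and `j` have the same height, and the word does not go below it between them. -/
def SameLevel (D M : ℤ → ℤ) (i j : ℤ) : Prop :=
  D i = D j ∧ ∀ k, (i ≤ k ∧ k < j ∨ j ≤ k ∧ k < i) → D i ≤ M k

/-- The relation generated by `SameLevel` and the period `2 * n`. -/
def LevelRel (n : ℤ) (D M : ℤ → ℤ) (i j : ℤ) : Prop :=
  ∃ t : ℤ, SameLevel D M i (j + 2 * n * t)

namespace SameLevel

variable {D M : ℤ → ℤ} {i j k : ℤ}

theorem symm (h : SameLevel D M i j) : SameLevel D M j i :=
  ⟨h.1.symm, fun k hk => h.1 ▸ h.2 k hk.symm⟩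

theorem trans (h : SameLevel D M i j) (h' : SameLevel D M j k) : SameLevel D M i k := by
  refine ⟨h.1.trans h'.1, fun l hl => ?_⟩
  by_cases hc : i ≤ l ∧ l < j ∨ j ≤ l ∧ l < i
  · exact h.2 l hc
  · rw [h.1]
    exact h'.2 l (by omega)

end SameLevel

namespace IsHeight

variable {n : ℤ} {D M : ℤ → ℤ}

theorem D_add_mul (h : IsHeight n D M) (i t : ℤ) : D (i + n * t) = D i := by
  rw [mul_comm]
  exact (show Function.Periodic D n from h.periodD).int_mul t i

theorem M_add_mul (h : IsHeight n D M) (i t : ℤ) : M (i + n * t) = M i := by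
  rw [mul_comm]
  exact (show Function.Periodic M n from h.periodM).int_mul t i

theorem reflect (h : IsHeight n D M) : IsHeight n (fun i => D (-i)) (fun i => M (-i - 1)) where
  periodD i := by
    rw [← h.periodD]
    congr 1
    ring
  periodM i := by
    rw [← h.periodM]
    congr 1
    ring
  le_left i := h.le_right _
  left_le i := h.right_le _
  le_right i := by
    rw [show -(i - 1) - 1 = -i by ring]
    exact h.le_left _
  right_le i := by
    rw [show -(i - 1) - 1 = -i by ring]
    exact h.left_le _

theorem sameLevel_reflect_iff {i j : ℤ} :
    SameLevel (fun i => D (-i)) (fun i => M (-i - 1)) i j ↔ SameLevel D M (-i) (-j) := by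
  refine and_congr_right fun _ => ⟨fun hk k hkij => ?_, fun hk k hkij => hk _ (by omega)⟩
  have : D (-i) ≤ M (-(-k - 1) - 1) := hk (-k - 1) (by omega)
  rwa [show -(-k - 1) - 1 = k by ring] at this

theorem levelRel_reflect_iff {i j : ℤ} :
    LevelRel n (fun i => D (-i)) (fun i => M (-i - 1)) i j ↔ LevelRel n D M (-i) (-j) := by
  constructor
  · rintro ⟨t, ht⟩
    refine ⟨-t, ?_⟩
    rw [sameLevel_reflect_iff] at ht
    rwa [show -j + 2 * n * -t = -(j + 2 * n * t) by ring]
  · rintro ⟨t, ht⟩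
    refine ⟨-t, ?_⟩
    rw [sameLevel_reflect_iff]
    rwa [show -(j + 2 * n * -t) = -j + 2 * n * t by ring]

theorem sameLevel_add_mul (h : IsHeight n D M) {i j : ℤ} (hij : SameLevel D M i j) (t : ℤ) :
    SameLevel D M (i + n * t) (j + n * t) := by
  refine ⟨by rw [h.D_add_mul, h.D_add_mul, hij.1], fun k hk => ?_⟩
  have := hij.2 (k + n * -t) (by rw [mul_neg]; omega)
  rwa [h.M_add_mul, ← h.D_add_mul i t] at this

/-- If two points at distance at least `n` have the same level, then this is the minimal one. -/
theorem le_of_sameLevel (h : IsHeight n D M) (hn : 0 < n) {i j : ℤ} (hij : SameLevel D M i j)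
    (hd : i + n ≤ j) (k : ℤ) : D i ≤ M k := by
  have h1 := Int.emod_nonneg (k - i) hn.ne'
  have h2 := Int.emod_lt_of_pos (k - i) hn
  have h3 := Int.emod_add_mul_ediv (k - i) n
  have := hij.2 (i + (k - i) % n) (by omega)
  rw [← h.M_add_mul _ ((k - i) / n)] at this
  convert this using 2
  omega

/-- Within one period, two points are related along one of the two arcs between them. -/
theorem levelRel_cases (h : IsHeight n D M) (hn : 0 < n) {i j : ℤ} (hij : i < j)
    (hj : j < i + 2 * n) (hr : LevelRel n D M i j) :
    SameLevel D M i j ∨ SameLevel D M (j - 2 * n) i := by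
  obtain ⟨t, ht⟩ := hr
  have hDj : D i = D j := by
    rw [ht.1, mul_comm 2 n, mul_assoc, h.D_add_mul]
  rcases lt_trichotomy t 0 with ht0 | rfl | ht0
  · rcases eq_or_lt_of_le (show t ≤ -1 by omega) with rfl | hlt
    · right
      rw [mul_neg, mul_one, ← sub_eq_add_neg] at ht
      exact ht.symm
    · left
      have : n * t ≤ n * -2 := Int.mul_le_mul_of_nonneg_left (by omega) hn.le
      rw [mul_assoc] at ht
      have hle := h.le_of_sameLevel hn ht.symm (by omega)
      exact ⟨hDj, fun k _ => ht.1 ▸ hle k⟩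
  · left
    simpa using ht
  · left
    have : n * 1 ≤ n * t := Int.mul_le_mul_of_nonneg_left (by omega) hn.le
    rw [mul_assoc] at ht
    exact ⟨hDj, fun k _ => h.le_of_sameLevel hn ht (by omega) k⟩

/-- On the line, levels are noncrossing without any restriction on the distances. -/
theorem sameLevel_noncrossing (h : IsHeight n D M) {i j k l : ℤ} (hij : i < j) (hjk : j < k)
    (hkl : k < l) (hik : SameLevel D M i k) (hjl : SameLevel D M j l) : SameLevel D M i j := by
  have h1 := hik.2 j (by omega)
  have h2 := h.le_left j
  have h3 := hjl.2 k (by omega)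
  have h4 := h.le_left k
  have h5 := hik.1
  exact ⟨by omega, fun m hm => hik.2 m (by omega)⟩

theorem isTypeBRel (h : IsHeight n D M) (hn : 0 < n) : IsTypeBRel n (LevelRel n D M) := by
  have refl : ∀ i, SameLevel D M i i := fun i => ⟨rfl, fun k hk => by omega⟩
  have of_sameLevel : ∀ {i j}, SameLevel D M i j → LevelRel n D M i j := fun {i j} hs =>
    ⟨0, by simpa using hs⟩
  have symm : ∀ {i j}, LevelRel n D M i j → LevelRel n D M j i := by
    rintro i j ⟨t, ht⟩
    refine ⟨-t, ?_⟩
    have := h.sameLevel_add_mul ht.symm (2 * -t)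
    convert this using 1 <;> ring
  have trans : ∀ {i j k}, LevelRel n D M i j → LevelRel n D M j k → LevelRel n D M i k := by
    rintro i j k ⟨t, ht⟩ ⟨s, hs⟩
    refine ⟨s + t, ht.trans ?_⟩
    have := h.sameLevel_add_mul hs (2 * t)
    convert this using 1 <;> ring
  have period : ∀ i, LevelRel n D M i (i + 2 * n) := fun i => ⟨-1, by simpa using refl i⟩
  have shift2 : ∀ {i j}, SameLevel D M (i - 2 * n) j → SameLevel D M i (j + 2 * n) := by
    intro i j hs
    have := h.sameLevel_add_mul hs 2
    convert this using 1 <;> ring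
  refine ⟨⟨fun i => of_sameLevel (refl i), symm, trans, period, ?_⟩, ?_⟩
  · intro i j k l hij hjk hkl hl hik hjl
    rcases h.levelRel_cases hn (by omega) (by omega) hjl with hjl | hjl
    · rcases h.levelRel_cases hn (by omega) (by omega) hik with hik | hik
      · exact of_sameLevel (h.sameLevel_noncrossing hij hjk hkl hik hjl)
      · have := h.sameLevel_noncrossing hjk hkl hl hjl (shift2 hik)
        exact symm (trans (of_sameLevel (this.trans (shift2 hik))) (symm (period i)))
    · rcases h.levelRel_cases hn (by omega) (by omega) hik with hik | hik
      · have := h.sameLevel_noncrossing (i := l - 2 * n) (by omega) hij hjk hjl hik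
        exact of_sameLevel (this.symm.trans hjl)
      · have := h.sameLevel_noncrossing (i := k - 2 * n) (j := l - 2 * n) (by omega) (by omega)
          hij hik hjl
        exact of_sameLevel ((hik.symm.trans this).trans hjl)
  · rintro i j ⟨t, ht⟩
    refine ⟨t, ?_⟩
    have := h.sameLevel_add_mul ht 1
    convert this using 1 <;> ring

/-- The openers are the integers preceded by an opening parenthesis. -/
theorem isOpener_iff (h : IsHeight n D M) (hn : 0 < n) {a : ℤ} :
    IsOpener n (LevelRel n D M) a ↔ D a = M (a - 1) + 1 := by
  constructor
  · intro ha
    by_contra hne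
    have h1 := h.le_right a
    have h2 := h.right_le a
    -- The last earlier point whose height is at most `D a` has the same level as `a`.
    obtain ⟨b, ⟨hba, hb⟩, hmax⟩ := Int.exists_greatest_of_bdd (P := fun z => z < a ∧ D z ≤ D a)
      ⟨a, fun z hz => hz.1.le⟩ ⟨a - n, by omega, by
        rw [← h.periodD (a - n), sub_add_cancel]⟩
    have hbn : a - n ≤ b := hmax _ ⟨by omega, by rw [← h.periodD (a - n), sub_add_cancel]⟩
    have hM : ∀ k, b ≤ k → k < a → D a ≤ M k := by
      intro k hbk hka
      rcases eq_or_lt_of_le (show k ≤ a - 1 by omega) with rfl | hlt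
      · omega
      · have h3 : ¬ D (k + 1) ≤ D a := fun h' => by
          have := hmax (k + 1) ⟨by omega, h'⟩
          omega
        have h4 := h.right_le (k + 1)
        rw [add_sub_cancel_right] at h4
        omega
    have h5 := hM b le_rfl hba
    have h6 := h.le_left b
    have h7 : D b = D a := by omega
    refine ha b hbn hba ⟨0, ?_⟩
    rw [mul_zero, add_zero]
    exact ⟨h7, fun k hk => h7 ▸ hM k (by omega) (by omega)⟩
  · intro ha b hb hba hr
    rcases h.levelRel_cases hn hba (by omega) hr with hs | hs
    · have h1 := hs.2 (a - 1) (by omega)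
      have h2 := hs.1
      omega
    · have h1 := h.le_of_sameLevel hn hs (by omega) (a - 1)
      have h2 := h.D_add_mul (a - 2 * n) 2
      rw [show a - 2 * n + n * 2 = a by ring] at h2
      omega

/-- The closers are the integers followed by a closing parenthesis. -/
theorem isCloser_iff (h : IsHeight n D M) (hn : 0 < n) {a : ℤ} :
    IsCloser n (LevelRel n D M) a ↔ D a = M a + 1 := by
  have h1 := h.reflect.isOpener_iff hn (a := -a)
  rw [show -(-a - 1) - 1 = a by ring, neg_neg] at h1
  rw [← h1, ← (h.isTypeBRel hn).isOpener_reflect_iff]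
  have : LevelRel n (fun i => D (-i)) (fun i => M (-i - 1)) =
      fun i j => LevelRel n D M (-i) (-j) := by
    funext i j
    exact propext levelRel_reflect_iff
  rw [this]

end IsHeight

theorem Int.ediv_sub_ediv_pred {n : ℤ} (hn : 0 < n) (a : ℤ) :
    a / n - (a - 1) / n = if n ∣ a then 1 else 0 := by
  have h1 := Int.emod_nonneg a hn.ne'
  have h2 := Int.emod_lt_of_pos a hn
  have h3 := Int.emod_add_mul_ediv a n
  split_ifs with h
  · have h4 := Int.emod_eq_zero_of_dvd h
    have : (a - 1) / n = a / n - 1 :=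
      ((Int.ediv_emod_unique hn (r := n - 1)).2
        ⟨by linarith [mul_sub n (a / n) 1], by omega, by omega⟩).1
    omega
  · have h4 : a % n ≠ 0 := fun h' => h (Int.dvd_of_emod_eq_zero h')
    have : (a - 1) / n = a / n :=
      ((Int.ediv_emod_unique hn (r := a % n - 1)).2 ⟨by linarith, by omega, by omega⟩).1
    omega

/-- For sets `L` and `R` of residues of the same size, there is a periodic parenthesis word whose
opening and closing parentheses are at `L` and `R`: the heights are the differences of the numbers
of opening and closing parentheses from some point on, which are sums of integer quotients. -/
theorem exists_isHeight {n : ℤ} (hn : 0 < n) (L R : Finset ℤ) (hLR : L.card = R.card)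
    (hL : ∀ x ∈ L, 0 ≤ x ∧ x < n) (hR : ∀ x ∈ R, 0 ≤ x ∧ x < n) :
    ∃ D M : ℤ → ℤ, IsHeight n D M ∧ ∀ a, 0 ≤ a → a < n →
      (D a = M (a - 1) + 1 ↔ a ∈ L) ∧ (D a = M a + 1 ↔ a ∈ R) := by
  have step : ∀ S : Finset ℤ, (∀ x ∈ S, 0 ≤ x ∧ x < n) → ∀ a,
      ∑ x ∈ S, (a - x) / n - ∑ x ∈ S, (a - 1 - x) / n = if a % n ∈ S then 1 else 0 := by
    intro S hS a
    rw [← Finset.sum_sub_distrib, ← Finset.sum_ite_eq S (a % n) fun _ => (1 : ℤ)]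
    refine Finset.sum_congr rfl fun x hx => ?_
    rw [sub_right_comm, Int.ediv_sub_ediv_pred hn]
    refine if_congr ?_ rfl rfl
    constructor
    · intro h
      exact (Int.emod_eq_emod_iff_emod_sub_eq_zero.2 (Int.emod_eq_zero_of_dvd h)).trans
        (Int.emod_eq_of_lt (hS x hx).1 (hS x hx).2)
    · rintro rfl
      exact Int.dvd_self_sub_emod
  have period : ∀ (S : Finset ℤ) (a : ℤ),
      ∑ x ∈ S, (a + n - x) / n = ∑ x ∈ S, (a - x) / n + S.card := by
    intro S a
    rw [Finset.card_eq_sum_ones, Nat.cast_sum, ← Finset.sum_add_distrib]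
    refine Finset.sum_congr rfl fun x _ => ?_
    rw [add_sub_right_comm, Int.add_ediv_of_dvd_right (dvd_refl n), Int.ediv_self hn.ne']
    rfl
  refine ⟨fun i => ∑ x ∈ L, (i - x) / n - ∑ x ∈ R, (i - 1 - x) / n,
    fun i => ∑ x ∈ L, (i - x) / n - ∑ x ∈ R, (i - x) / n, ⟨?_, ?_, ?_, ?_, ?_, ?_⟩, ?_⟩
  · intro i
    have h1 := period L i
    have h2 := period R (i - 1)
    rw [sub_add_eq_add_sub] at h2
    omega
  · intro i
    have h1 := period L i
    have h2 := period R i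
    omega
  · intro i
    have h2 := step R hR i
    split_ifs at h2 <;> omega
  · intro i
    have h2 := step R hR i
    split_ifs at h2 <;> omega
  · intro i
    have h2 := step L hL i
    split_ifs at h2 <;> omega
  · intro i
    have h2 := step L hL i
    split_ifs at h2 <;> omega
  · intro a h0 ha
    have h1 := step L hL a
    have h2 := step R hR a
    rw [Int.emod_eq_of_lt h0 ha] at h1 h2
    beta_reduce
    constructor
    · split_ifs at h1 with hc
      · exact iff_of_true (by omega) hc
      · exact iff_of_false (by omega) hc
    · split_ifs at h2 with hc
      · exact iff_of_true (by omega) hc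
      · exact iff_of_false (by omega) hc

/-! ### Unrolling the circle of signed symbols -/

namespace SignedSymbol

variable {n : ℕ}

theorem bar_bar (x : SignedSymbol n) : x.bar.bar = x := by
  simp [bar]

theorem circlePos_lt (x : SignedSymbol n) : x.circlePos < 2 * n := by
  have := x.1.isLt
  unfold circlePos abs
  split_ifs <;> omega

theorem circlePos_injective : Function.Injective (circlePos : SignedSymbol n → ℕ) := by
  rintro ⟨i, c⟩ ⟨j, d⟩ h
  have hi := i.isLt
  have hj := j.isLt
  unfold circlePos abs barred at h
  cases c <;> cases d <;> simp at h <;> simp [Fin.ext_iff] <;> omega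

theorem circlePos_bar (x : SignedSymbol n) :
    ((x.bar.circlePos : ℕ) : ℤ) = ((x.circlePos : ℤ) + n) % (2 * n) := by
  obtain ⟨i, c⟩ := x
  have hi := i.isLt
  cases c
  · rw [Int.emod_eq_of_lt] <;> simp [circlePos, bar, barred, abs] <;> omega
  · have : (n : ℤ) + i + n = i + 2 * n := by ring
    simp only [circlePos, bar, barred, abs, Bool.not_true, Bool.false_eq_true, if_true, if_false,
      Nat.cast_add, this, Int.add_emod_right]
    rw [Int.emod_eq_of_lt] <;> omega

variable [NeZero n]

/-- The symbol at position `i` modulo `2 * n` on the circle. -/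
def ofInt (n : ℕ) [NeZero n] (i : ℤ) : SignedSymbol n :=
  (Fin.ofNat n (i % n).toNat, decide ((n : ℤ) ≤ i % (2 * n)))

theorem circlePos_ofInt (i : ℤ) : ((ofInt n i).circlePos : ℤ) = i % (2 * n) := by
  have hn : (0 : ℤ) < n := by exact_mod_cast NeZero.pos n
  have h1 := Int.emod_nonneg i hn.ne'
  have h2 := Int.emod_lt_of_pos i hn
  have h3 := Int.emod_emod_of_dvd i (Dvd.intro_left 2 rfl : (n : ℤ) ∣ 2 * n)
  have h4 := Int.emod_nonneg i (show (2 * n : ℤ) ≠ 0 by omega)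
  have h5 := Int.emod_lt_of_pos i (show (0 : ℤ) < 2 * n by omega)
  have hval : (i % n).toNat % n = (i % n).toNat := Nat.mod_eq_of_lt (by omega)
  simp only [circlePos, ofInt, barred, abs, Fin.ofNat, hval, decide_eq_true_eq]
  by_cases hc : (n : ℤ) ≤ i % (2 * n)
  · rw [if_pos hc, ← h3, ← Int.sub_emod_right, Int.emod_eq_of_lt (by omega) (by omega)]
    omega
  · rw [if_neg hc, ← h3, Int.emod_eq_of_lt h4 (by omega)]
    omega

theorem ofInt_circlePos (x : SignedSymbol n) : ofInt n x.circlePos = x := by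
  refine circlePos_injective ?_
  have := x.circlePos_lt
  zify
  rw [circlePos_ofInt, Int.emod_eq_of_lt] <;> omega

theorem ofInt_eq_iff {i j : ℤ} : ofInt n i = ofInt n j ↔ i % (2 * n) = j % (2 * n) := by
  rw [← circlePos_ofInt, ← circlePos_ofInt, Nat.cast_inj, circlePos_injective.eq_iff]

theorem bar_ofInt (i : ℤ) : (ofInt n i).bar = ofInt n (i + n) := by
  refine circlePos_injective ?_
  zify
  rw [circlePos_bar, circlePos_ofInt, circlePos_ofInt, Int.emod_add_emod]

end SignedSymbol

open SignedSymbol in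
/-- In a bar-invariant noncrossing partition, two elements of bar-invariant blocks lie in the same
block: otherwise the diameters through these elements would cross. -/
theorem IsNoncrossing.rel_of_rel_bar {n : ℕ} {π : Setoid (SignedSymbol n)} (h : IsNoncrossing π)
    {x y : SignedSymbol n} (hx : π x x.bar) (hy : π y y.bar) : π x y := by
  have hlt : ∀ i j : Fin n, i < j → π (i, false) (i, true) → π (j, false) (j, true) →
      π (i, false) (j, false) := by
    intro i j hij hi hj
    have := i.isLt
    have := j.isLt
    have : (i : ℕ) < j := hij
    exact h (i, false) (j, false) (i, true) (j, true)
      (by simpa [circlePos, barred, SignedSymbol.abs])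
      (by simp [circlePos, barred, SignedSymbol.abs]; omega)
      (by simpa [circlePos, barred, SignedSymbol.abs]) hi hj
  have hunbar : ∀ z : SignedSymbol n, π z z.bar → π (z.1, false) (z.1, true) ∧
      π z (z.1, false) := by
    rintro ⟨i, _ | _⟩ hz
    · exact ⟨hz, π.refl _⟩
    · exact ⟨π.symm hz, hz⟩
  obtain ⟨hx1, hx2⟩ := hunbar x hx
  obtain ⟨hy1, hy2⟩ := hunbar y hy
  refine π.trans hx2 (π.trans ?_ (π.symm hy2))
  rcases lt_trichotomy x.1 y.1 with hxy | hxy | hxy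
  · exact hlt _ _ hxy hx1 hy1
  · rw [hxy]
  · exact π.symm (hlt _ _ hxy hy1 hx1)

theorem bar_image_class {n : ℕ} {π : Setoid (SignedSymbol n)}
    (h : ∀ x y : SignedSymbol n, π x y → π x.bar y.bar) (x : SignedSymbol n) :
    SignedSymbol.bar '' {z | π z x} = {z | π z x.bar} := by
  ext z
  constructor
  · rintro ⟨w, hw, rfl⟩
    exact h _ _ hw
  · intro hz
    refine ⟨z.bar, ?_, z.bar_bar⟩
    have := h _ _ hz
    rwa [x.bar_bar] at this

theorem isTypeBPartition_of_isNoncrossing {n : ℕ} {π : Setoid (SignedSymbol n)}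
    (h : ∀ x y : SignedSymbol n, π x y → π x.bar y.bar) (hnc : IsNoncrossing π) :
    IsTypeBPartition π := by
  constructor
  · rintro _ ⟨x, rfl⟩
    exact ⟨x.bar, bar_image_class h x⟩
  · rintro _ ⟨⟨x, rfl⟩, hx⟩ _ ⟨⟨y, rfl⟩, hy⟩
    have key : ∀ z : SignedSymbol n, SignedSymbol.bar '' {w | π w z} = {w | π w z} →
        π z z.bar := by
      intro z hz
      have : z ∈ SignedSymbol.bar '' {w | π w z} := by
        rw [hz]
        exact π.refl z
      rwa [bar_image_class h] at this
    have hxy := hnc.rel_of_rel_bar (key x hx) (key y hy)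
    ext w
    exact ⟨fun hw => π.trans hw hxy, fun hw => π.trans hw (π.symm hxy)⟩

namespace NCB

open SignedSymbol

variable {n : ℕ}

theorem rel_bar (π : NCB n) {x y : SignedSymbol n} (h : π.1 x y) : π.1 x.bar y.bar := by
  obtain ⟨w, hw⟩ := π.2.1.1 {z | π.1 z y} ⟨y, rfl⟩
  have hx : x.bar ∈ {z | π.1 z w} := hw ▸ ⟨x, h, rfl⟩
  have hy : y.bar ∈ {z | π.1 z w} := hw ▸ ⟨y, π.1.refl y, rfl⟩
  exact π.1.trans hx (π.1.symm hy)

theorem rel_of_rel_bar (π : NCB n) {x y : SignedSymbol n} (hx : π.1 x x.bar) (hy : π.1 y y.bar) :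
    π.1 x y :=
  π.2.2.rel_of_rel_bar hx hy

/-- The discrete partition. -/
def discrete (n : ℕ) : NCB n :=
  have h : IsNoncrossing (⊥ : Setoid (SignedSymbol n)) := fun a b c d hab hbc hcd hac => by
    have : a = c := hac
    subst this
    exact absurd (hab.trans hbc) (lt_irrefl _)
  ⟨⊥, isTypeBPartition_of_isNoncrossing (fun x y hxy => by rw [show x = y from hxy]) h, h⟩

/-- A set of absolute values whose symbols form a system of representatives of the non-zero
blocks. -/
structure IsTransversal (π : NCB n) (S : Finset (Fin n)) : Prop where
  not_rel_bar : ∀ x : SignedSymbol n, x.1 ∈ S → ¬ π.1 x x.bar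
  eq_of_rel : ∀ x y : SignedSymbol n, x.1 ∈ S → y.1 ∈ S → π.1 x y → x = y
  exists_rel : ∀ x : SignedSymbol n, ¬ π.1 x x.bar → ∃ y : SignedSymbol n, y.1 ∈ S ∧ π.1 y x

/-- A transversal has one element for every pair of non-zero blocks. -/
theorem IsTransversal.card_eq {π : NCB n} {S : Finset (Fin n)} (h : π.IsTransversal S) :
    {p : Set (Set (SignedSymbol n)) | ∃ β ∈ π.1.classes,
      SignedSymbol.bar '' β ≠ β ∧ p = {β, SignedSymbol.bar '' β}}.ncard = S.card := by
  have himg := bar_image_class (π := π.1) fun x y => π.rel_bar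
  have hclass : ∀ x y : SignedSymbol n, {z | π.1 z x} = {z | π.1 z y} ↔ π.1 x y := by
    intro x y
    constructor
    · intro he
      have : x ∈ {z | π.1 z y} := he ▸ π.1.refl x
      exact this
    · intro hxy
      ext z
      exact ⟨fun hz => π.1.trans hz hxy, fun hz => π.1.trans hz (π.1.symm hxy)⟩
  let g : Fin n → Set (Set (SignedSymbol n)) := fun i =>
    {{z | π.1 z (i, false)}, {z | π.1 z (i, true)}}
  have hg : ∀ x : SignedSymbol n, ({{z | π.1 z x}, {z | π.1 z x.bar}} : Set _) = g x.1 := by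
    rintro ⟨i, _ | _⟩
    · rfl
    · exact Set.pair_comm _ _
  have hinj : Set.InjOn g S := by
    intro i hi j hj hij
    have : {z | π.1 z (i, false)} ∈ g j := hij ▸ Set.mem_insert _ _
    rcases this with he | he
    · exact congrArg Prod.fst (h.eq_of_rel _ _ hi hj ((hclass _ _).1 he))
    · exact congrArg Prod.fst (h.eq_of_rel _ _ hi hj ((hclass _ _).1 he))
  rw [← Set.ncard_coe_finset, ← hinj.ncard_image]
  congr 1
  ext p
  constructor
  · rintro ⟨_, ⟨x, rfl⟩, hne, rfl⟩
    rw [himg, Ne, hclass] at hne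
    obtain ⟨y, hy, hyx⟩ := h.exists_rel x fun hx => hne (π.1.symm hx)
    refine ⟨y.1, hy, ?_⟩
    rw [← hg, himg, (hclass y x).2 hyx, (hclass _ _).2 (π.rel_bar hyx)]
  · rintro ⟨i, hi, rfl⟩
    refine ⟨{z | π.1 z (i, false)}, ⟨_, rfl⟩, ?_, ?_⟩
    · rw [himg, Ne, hclass]
      exact fun hr => h.not_rel_bar (i, false) hi (π.1.symm hr)
    · rw [himg]
      rfl

section Unroll

variable [NeZero n]

/-- The unrolling of a partition of the circle to a periodic relation on `ℤ`. -/
def rel (π : NCB n) (i j : ℤ) : Prop := π.1 (ofInt n i) (ofInt n j)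

theorem isTypeBRel_rel (π : NCB n) : IsTypeBRel n π.rel := by
  have hn : (0 : ℤ) < n := by exact_mod_cast NeZero.pos n
  have refl : ∀ i, π.rel i i := fun i => π.1.refl _
  have symm : ∀ {i j}, π.rel i j → π.rel j i := fun h => π.1.symm h
  have trans : ∀ {i j k}, π.rel i j → π.rel j k → π.rel i k := fun h h' => π.1.trans h h'
  have period : ∀ i t, π.rel i (i + 2 * n * t) := fun i t => by
    have : ofInt n i = ofInt n (i + 2 * n * t) := by
      rw [ofInt_eq_iff, Int.add_mul_emod_self_left]
    rw [rel, this]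
  have base : ∀ {a b c d : ℤ}, 0 ≤ a → a < b → b < c → c < d → d < 2 * n → π.rel a c → π.rel b d →
      π.rel a b := by
    intro a b c d h0 hab hbc hcd hd hac hbd
    refine π.2.2 _ _ _ _ ?_ ?_ ?_ hac hbd <;> zify <;>
      rwa [circlePos_ofInt, circlePos_ofInt, Int.emod_eq_of_lt, Int.emod_eq_of_lt] <;> omega
  -- The case `0 ≤ i < 2 * n`: rotate the four points so that all lie between `0` and `2 * n`.
  have base' : ∀ {i j k l : ℤ}, 0 ≤ i → i < 2 * n → i < j → j < k → k < l → l < i + 2 * n →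
      π.rel i k → π.rel j l → π.rel i j := by
    intro i j k l h0 hi hij hjk hkl hl hik hjl
    have back : ∀ x, π.rel x (x - 2 * n) := fun x => by
      have := period x (-1)
      rwa [mul_neg, mul_one, ← sub_eq_add_neg] at this
    by_cases hl2 : l < 2 * n
    · exact base h0 hij hjk hkl hl2 hik hjl
    · by_cases hk2 : k < 2 * n
      · have := base (a := l - 2 * n) (b := i) (c := j) (d := k) (by omega) (by omega) hij hjk hk2
          (trans (symm (back l)) (symm hjl)) hik
        exact symm (trans hjl (trans (back l) this))
      · by_cases hj2 : j < 2 * n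
        · have := base (a := k - 2 * n) (b := l - 2 * n) (c := i) (d := j) (by omega) (by omega)
            (by omega) hij hj2 (trans (symm (back k)) (symm hik))
            (trans (symm (back l)) (symm hjl))
          exact trans hik (trans (back k) (trans this (trans (symm (back l)) (symm hjl))))
        · have := base (a := j - 2 * n) (b := k - 2 * n) (c := l - 2 * n) (d := i) (by omega)
            (by omega) (by omega) (by omega) (by omega)
            (trans (symm (back j)) (trans hjl (back l))) (trans (symm (back k)) (symm hik))
          exact trans hik (trans (back k) (trans (symm this) (symm (back j))))
  refine ⟨⟨refl, symm, trans, fun i => ?_, ?_⟩, ?_⟩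
  · have := period i 1
    rwa [mul_one] at this
  · intro i j k l hij hjk hkl hl hik hjl
    have h1 := Int.emod_nonneg i (show (2 * n : ℤ) ≠ 0 by omega)
    have h2 := Int.emod_lt_of_pos i (show (0 : ℤ) < 2 * n by omega)
    have h3 := Int.emod_add_mul_ediv i (2 * n)
    generalize i / (2 * n) = t at h3
    have hneg : 2 * (n : ℤ) * -t = -(2 * n * t) := mul_neg _ _
    have tr : ∀ {x y}, π.rel (x + 2 * n * -t) (y + 2 * n * -t) ↔ π.rel x y := fun {x y} =>
      ⟨fun h => trans (period x _) (trans h (symm (period y _))),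
        fun h => trans (symm (period x _)) (trans h (period y _))⟩
    exact tr.1 (base' (by omega) (by omega) (by omega) (by omega) (by omega) (by omega)
      (tr.2 hik) (tr.2 hjl))
  · intro i j h
    have := π.rel_bar h
    rwa [bar_ofInt, bar_ofInt] at this

theorem rel_circlePos (π : NCB n) {x y : SignedSymbol n} :
    π.rel x.circlePos y.circlePos ↔ π.1 x y := by
  rw [rel, ofInt_circlePos, ofInt_circlePos]

/-- The partition of the circle given by a type-B relation on `ℤ`. -/
def ofRel {r : ℤ → ℤ → Prop} (h : IsTypeBRel n r) : NCB n :=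
  have hnc : IsNoncrossing (n := n) ⟨fun x y => r x.circlePos y.circlePos,
      ⟨fun _ => h.refl _, h.symm, h.trans⟩⟩ := by
    intro a b c d hab hbc hcd hac hbd
    have := d.circlePos_lt
    exact h.noncrossing (by omega) (by omega) (by omega) (by omega) hac hbd
  ⟨_, isTypeBPartition_of_isNoncrossing (fun x y hxy => by
    have mod : ∀ i : ℤ, r (i % (2 * n)) i := fun i => by
      have := h.period_mul (i % (2 * n)) (i / (2 * n))
      rwa [Int.emod_add_mul_ediv] at this
    change r x.bar.circlePos y.bar.circlePos
    rw [circlePos_bar, circlePos_bar]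
    exact h.trans (mod _) (h.trans (h.shift hxy) (h.symm (mod _)))) hnc, hnc⟩

theorem rel_ofRel {r : ℤ → ℤ → Prop} (h : IsTypeBRel n r) {i j : ℤ} :
    (ofRel h).rel i j ↔ r i j := by
  have mod : ∀ i : ℤ, r (i % (2 * n)) i := fun i => by
    have := h.period_mul (i % (2 * n)) (i / (2 * n))
    rwa [Int.emod_add_mul_ediv] at this
  change r (ofInt n i).circlePos (ofInt n j).circlePos ↔ _
  rw [circlePos_ofInt, circlePos_ofInt]
  exact ⟨fun hr => h.trans (h.symm (mod i)) (h.trans hr (mod j)),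
    fun hr => h.trans (mod i) (h.trans hr (h.symm (mod j)))⟩

theorem ext_rel {π π' : NCB n}
    (h : ∀ i j : ℤ, i < j → j < i + 2 * n → (π.rel i j ↔ π'.rel i j)) : π = π' := by
  refine Subtype.ext (Setoid.ext fun x y => ?_)
  have hx := x.circlePos_lt
  have hy := y.circlePos_lt
  rcases lt_trichotomy x.circlePos y.circlePos with hlt | heq | hgt
  · have := h x.circlePos y.circlePos (by omega) (by omega)
    rwa [rel_circlePos, rel_circlePos] at this
  · rw [circlePos_injective heq]
    exact iff_of_true (π.1.refl y) (π'.1.refl y)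
  · have := h y.circlePos x.circlePos (by omega) (by omega)
    rw [rel_circlePos, rel_circlePos] at this
    exact π.1.comm'.trans (this.trans π'.1.comm')

/-! ### Openers and closers of a noncrossing partition -/

open Classical in
/-- The absolute values of the clockwise first elements of the non-zero blocks. -/
noncomputable def openers (π : NCB n) : Finset (Fin n) :=
  Finset.univ.filter fun i => IsOpener n π.rel (i : ℕ)

open Classical in
/-- The absolute values of the clockwise last elements of the non-zero blocks. -/
noncomputable def closers (π : NCB n) : Finset (Fin n) :=
  Finset.univ.filter fun i => IsCloser n π.rel (i : ℕ)

theorem mem_openers {π : NCB n} {i : Fin n} : i ∈ π.openers ↔ IsOpener n π.rel (i : ℕ) := by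
  simp [openers]

theorem mem_closers {π : NCB n} {i : Fin n} : i ∈ π.closers ↔ IsCloser n π.rel (i : ℕ) := by
  simp [closers]

theorem iff_ofInt_of_periodic {P : ℤ → Prop} (hP : ∀ a, P (a + n) ↔ P a) (a : ℤ) :
    P a ↔ P (((ofInt n a).1 : ℕ) : ℤ) := by
  have hn : (0 : ℤ) < n := by exact_mod_cast NeZero.pos n
  have h1 := Int.emod_nonneg a hn.ne'
  have h2 := Int.emod_lt_of_pos a hn
  have hval : (((ofInt n a).1 : ℕ) : ℤ) = a % n := by
    simp only [ofInt, Fin.ofNat]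
    rw [Nat.mod_eq_of_lt (by omega), Int.toNat_of_nonneg h1]
  have hper : Function.Periodic P n := fun a => propext (hP a)
  have : P (a % n + a / n * n) = P (a % n) := hper.int_mul (a / n) (a % n)
  rw [mul_comm, Int.emod_add_mul_ediv] at this
  rw [hval, this]

theorem isOpener_iff_mem (π : NCB n) (a : ℤ) :
    IsOpener n π.rel a ↔ (ofInt n a).1 ∈ π.openers := by
  rw [mem_openers, ← iff_ofInt_of_periodic fun _ => π.isTypeBRel_rel.isOpener_add_iff]

theorem isCloser_iff_mem (π : NCB n) (a : ℤ) :
    IsCloser n π.rel a ↔ (ofInt n a).1 ∈ π.closers := by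
  rw [mem_closers, ← iff_ofInt_of_periodic fun _ => π.isTypeBRel_rel.isCloser_add_iff]

theorem isTransversal_of {π : NCB n} {P : ℤ → Prop} {S : Finset (Fin n)}
    (hP : ∀ a, P a ↔ (ofInt n a).1 ∈ S) (h1 : ∀ a, P a → ¬ π.rel a (a + n))
    (h2 : ∀ a b : ℤ, a < b → b < a + 2 * n → P a → P b → ¬ π.rel a b)
    (h3 : ∀ x, ¬ π.rel x (x + n) → ∃ a, P a ∧ π.rel a x) : π.IsTransversal S := by
  have hP' : ∀ x : SignedSymbol n, x.1 ∈ S → P x.circlePos := fun x hx => by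
    rwa [hP, ofInt_circlePos]
  have hbar : ∀ x : SignedSymbol n, π.rel x.circlePos (x.circlePos + n) ↔ π.1 x x.bar :=
    fun x => by rw [rel, ← bar_ofInt, ofInt_circlePos]
  refine ⟨fun x hx => ?_, fun x y hx hy hxy => ?_, fun x hx => ?_⟩
  · rw [← hbar]
    exact h1 _ (hP' x hx)
  · have hx' := x.circlePos_lt
    have hy' := y.circlePos_lt
    rcases lt_trichotomy x.circlePos y.circlePos with hlt | heq | hgt
    · exact absurd (π.rel_circlePos.2 hxy)
        (h2 _ _ (by omega) (by omega) (hP' x hx) (hP' y hy))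
    · exact circlePos_injective heq
    · exact absurd (π.rel_circlePos.2 (π.1.symm hxy))
        (h2 _ _ (by omega) (by omega) (hP' y hy) (hP' x hx))
  · rw [← hbar] at hx
    obtain ⟨a, ha, hr⟩ := h3 _ hx
    refine ⟨ofInt n a, (hP a).1 ha, ?_⟩
    rwa [rel, ofInt_circlePos] at hr

theorem isTransversal_openers (π : NCB n) : π.IsTransversal π.openers :=
  have hn : (0 : ℤ) < n := by exact_mod_cast NeZero.pos n
  have h := π.isTypeBRel_rel
  isTransversal_of π.isOpener_iff_mem (fun _ => h.not_rel_add_of_isOpener hn)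
    (fun _ _ => h.not_rel_of_isOpener) fun _ => h.exists_isOpener hn

theorem isTransversal_closers (π : NCB n) : π.IsTransversal π.closers :=
  have hn : (0 : ℤ) < n := by exact_mod_cast NeZero.pos n
  have h := π.isTypeBRel_rel
  isTransversal_of π.isCloser_iff_mem (fun _ => IsTypeBRel.not_rel_add_of_isCloser hn)
    (fun _ _ => h.not_rel_of_isCloser) fun _ => h.exists_isCloser hn

theorem card_openers_eq_card_closers (π : NCB n) : π.openers.card = π.closers.card :=
  π.isTransversal_openers.card_eq.symm.trans π.isTransversal_closers.card_eq

theorem rank_eq (π : NCB n) : π.rank = π.openersᶜ.card := by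
  rw [rank, π.isTransversal_openers.card_eq, Finset.card_compl, Fintype.card_fin]

/-! ### Noncrossing partitions as pairs of subsets -/

/-- The complements of the sets of openers and of closers. -/
noncomputable def toPair (π : NCB n) : EqualCardPair n :=
  ⟨(π.openersᶜ, π.closersᶜ), by
    rw [Finset.card_compl, Finset.card_compl, card_openers_eq_card_closers]⟩

theorem eq_of_openers_eq_of_closers_eq {π π' : NCB n} (ho : π.openers = π'.openers)
    (hc : π.closers = π'.closers) : π = π' :=
  ext_rel fun _ _ hij hj => π.isTypeBRel_rel.rel_iff_rel π'.isTypeBRel_rel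
    (fun a => by rw [isOpener_iff_mem, isOpener_iff_mem, ho])
    (fun a => by rw [isCloser_iff_mem, isCloser_iff_mem, hc]) hij hj

theorem toPair_injective : Function.Injective (toPair : NCB n → EqualCardPair n) :=
  fun _ _ h => eq_of_openers_eq_of_closers_eq
    (compl_injective (congrArg (fun p => p.1.1) h)) (compl_injective (congrArg (fun p => p.1.2) h))

theorem toPair_surjective : Function.Surjective (toPair : NCB n → EqualCardPair n) := by
  rintro ⟨⟨S, T⟩, hST⟩
  change S.card = T.card at hST
  have hn : (0 : ℤ) < n := by exact_mod_cast NeZero.pos n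
  let e : Fin n ↪ ℤ := ⟨fun i => ((i : ℕ) : ℤ), fun i j h => by
    exact Fin.ext (Int.ofNat_inj.1 h)⟩
  have he : ∀ (U : Finset (Fin n)), ∀ x ∈ U.map e, 0 ≤ x ∧ x < n := by
    intro U x hx
    obtain ⟨i, _, rfl⟩ := Finset.mem_map.1 hx
    exact ⟨Int.natCast_nonneg _, Int.ofNat_lt.2 i.isLt⟩
  obtain ⟨D, M, h, hDM⟩ := exists_isHeight hn (Sᶜ.map e) (Tᶜ.map e)
    (by rw [Finset.card_map, Finset.card_map, Finset.card_compl, Finset.card_compl, hST])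
    (he _) (he _)
  have hDM' := fun i : Fin n =>
    hDM (e i) (Int.natCast_nonneg _) (Int.ofNat_lt.2 i.isLt)
  let π : NCB n := ofRel (h.isTypeBRel hn)
  have hrel : π.rel = LevelRel n D M := by
    funext i j
    exact propext (rel_ofRel _)
  have ho : π.openers = Sᶜ := by
    ext i
    rw [mem_openers, hrel, h.isOpener_iff hn, ← Finset.mem_map' e]
    exact (hDM' i).1
  have hc : π.closers = Tᶜ := by
    ext i
    rw [mem_closers, hrel, h.isCloser_iff hn, ← Finset.mem_map' e]
    exact (hDM' i).2
  refine ⟨π, Subtype.ext (Prod.ext ?_ ?_)⟩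
  · change π.openersᶜ = S
    rw [ho, compl_compl]
  · change π.closersᶜ = T
    rw [hc, compl_compl]

theorem openers_subset_of_le {π π' : NCB n} (h : π ≤ π') : π'.openers ⊆ π.openers := by
  intro i hi
  rw [mem_openers] at hi ⊢
  exact fun b hb hb' hr => hi b hb hb' (h hr)

theorem closers_subset_of_le {π π' : NCB n} (h : π ≤ π') : π'.closers ⊆ π.closers := by
  intro i hi
  rw [mem_closers] at hi ⊢
  exact fun b hb hb' hr => hi b hb hb' (h hr)

/-- The set of openers shrinks strictly when blocks are merged: if the sets of openers were equal,
then so would be the numbers of closers, hence the sets of closers, hence the partitions. -/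
theorem openers_ssubset_of_lt {π π' : NCB n} (h : π < π') : π'.openers ⊂ π.openers := by
  refine (openers_subset_of_le h.le).ssubset_of_ne fun ho => h.ne' ?_
  refine eq_of_openers_eq_of_closers_eq ho
    (Finset.eq_of_subset_of_card_le (closers_subset_of_le h.le) ?_)
  rw [← card_openers_eq_card_closers, ← card_openers_eq_card_closers, ho]

/-! ### The rank function of noncrossing partitions -/

theorem two_mul_card_openers_le (π : NCB n) : 2 * π.openers.card ≤ Nat.card (Quotient π.1) := by
  have hinj : Function.Injective fun y : π.openers × Bool =>
      (Quotient.mk π.1 (y.1.1, y.2)) := by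
    rintro ⟨i, c⟩ ⟨j, d⟩ h
    have := π.isTransversal_openers.eq_of_rel (i.1, c) (j.1, d) i.2 j.2 (Quotient.exact h)
    obtain ⟨h1, h2⟩ := Prod.mk.inj this
    exact Prod.ext (Subtype.ext h1) h2
  have := Nat.card_le_card_of_injective _ hinj
  rwa [Nat.card_prod, Nat.card_eq_fintype_card, Nat.card_eq_fintype_card, Fintype.card_coe,
    Fintype.card_bool, mul_comm] at this

open Classical in
theorem card_quotient_le (π : NCB n) : Nat.card (Quotient π.1) ≤ 2 * π.openers.card + 1 := by
  choose y hy using π.isTransversal_openers.exists_rel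
  let g : Quotient π.1 → Option (π.openers × Bool) := fun q =>
    if h : π.1 q.out q.out.bar then none else
      some (⟨(y q.out h).1, (hy q.out h).1⟩, (y q.out h).2)
  have hinj : Function.Injective g := by
    intro p q hpq
    rw [← p.out_eq, ← q.out_eq]
    refine Quotient.sound ?_
    by_cases hp : π.1 p.out p.out.bar <;> by_cases hq : π.1 q.out q.out.bar
    · exact π.rel_of_rel_bar hp hq
    · simp [g, hp, hq] at hpq
    · simp [g, hp, hq] at hpq
    · have h : y p.out hp = y q.out hq := by
        simp only [g, hp, hq, dif_neg, not_false_eq_true, Option.some.injEq, Prod.mk.injEq,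
          Subtype.mk.injEq] at hpq
        exact Prod.ext hpq.1 hpq.2
      exact π.1.trans (π.1.symm (hy p.out hp).2) (h ▸ (hy q.out hq).2)
  have := Nat.card_le_card_of_injective _ hinj
  rwa [Finite.card_option, Nat.card_prod, Nat.card_eq_fintype_card (α := π.openers),
    Nat.card_eq_fintype_card (α := Bool), Fintype.card_coe, Fintype.card_bool, mul_comm] at this

/-- If `π < π'`, then two neighbours in a block of `π'` lie in different blocks of `π`; take such
neighbours at minimal distance. -/
theorem exists_neighbours {π π' : NCB n} (h : π < π') : ∃ a b : ℤ, a < b ∧ b < a + 2 * n ∧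
    π'.rel a b ∧ ¬ π.rel a b ∧ ∀ c, a < c → c < b → ¬ π'.rel c b := by
  have hex : ∃ d : ℕ, ∃ a : ℤ, d < 2 * n ∧ π'.rel a (a + d) ∧ ¬ π.rel a (a + d) := by
    by_contra hno
    push Not at hno
    refine h.not_ge fun {x y} hxy => ?_
    rw [← rel_circlePos] at hxy ⊢
    have hx := x.circlePos_lt
    have hy := y.circlePos_lt
    rcases le_total x.circlePos y.circlePos with hle | hle
    · have := hno (y.circlePos - x.circlePos) x.circlePos (by omega)
      rw [Nat.cast_sub hle, add_sub_cancel] at this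
      exact this hxy
    · have := hno (x.circlePos - y.circlePos) y.circlePos (by omega)
      rw [Nat.cast_sub hle, add_sub_cancel] at this
      exact π.isTypeBRel_rel.symm (this (π'.isTypeBRel_rel.symm hxy))
  classical
  obtain ⟨a, hd, hr', hr⟩ := Nat.find_spec hex
  have hmin := fun m hm => Nat.find_min hex (m := m) hm
  generalize Nat.find hex = d at *
  have hlt : ∀ i j : ℤ, i < j → j - i < d → π'.rel i j → π.rel i j := by
    intro i j hij hdij hrij
    by_contra hnr
    have hc : ((j - i).toNat : ℤ) = j - i := Int.toNat_of_nonneg (by omega)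
    exact hmin (j - i).toNat (by omega) ⟨i, by omega, by
      rwa [hc, add_sub_cancel], by rwa [hc, add_sub_cancel]⟩
  have hd0 : d ≠ 0 := by
    rintro rfl
    exact hr (by simpa using π.isTypeBRel_rel.refl a)
  refine ⟨a, a + d, by omega, by omega, hr', hr, fun c hac hcb hrc => hr ?_⟩
  exact π.isTypeBRel_rel.trans
    (hlt a c hac (by omega) (π'.isTypeBRel_rel.trans hr' (π'.isTypeBRel_rel.symm hrc)))
    (hlt c (a + d) hcb (by omega) hrc)

/-- If `π'` covers `π`, then `π'` results from `π` by merging the blocks of two neighbours, and the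
bars of these blocks. -/
theorem exists_mergeRel_of_covBy {π π' : NCB n} (h : π ⋖ π') : ∃ a b : ℤ, ∀ i j, π'.rel i j ↔
    mergeRel (mergeRel π.rel a b) (a + n) (b + n) i j := by
  obtain ⟨a, b, hab, hb, hr', hr, hadj⟩ := exists_neighbours h.lt
  have hπ := π.isTypeBRel_rel
  have hπ' := π'.isTypeBRel_rel
  have hle : ∀ {i j}, π.rel i j → π'.rel i j := fun hij => h.lt.le hij
  have h1 := hπ.mergeRel hπ'.toIsNoncrossingRel hle hab hb hr' hadj
  have hle1 : ∀ {i j}, mergeRel π.rel a b i j → π'.rel i j :=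
    mergeRel_le hπ'.equivalence hle hr'
  have h2 := h1.mergeRel hπ'.toIsNoncrossingRel hle1 (a := a + n) (b := b + n) (by omega)
    (by omega) (hπ'.shift hr') fun c hac hcb hrc => hadj (c - n) (by omega) (by omega)
      (hπ'.shift_iff.1 (by rwa [sub_add_cancel]))
  have hle2 : ∀ {i j}, mergeRel (mergeRel π.rel a b) (a + n) (b + n) i j → π'.rel i j :=
    mergeRel_le hπ'.equivalence hle1 (hπ'.shift hr')
  have hB : IsTypeBRel n (mergeRel (mergeRel π.rel a b) (a + n) (b + n)) := by
    refine ⟨h2, fun {i j} hij => ?_⟩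
    have shift1 : ∀ {x}, π.rel x a ∨ π.rel x b →
        mergeRel π.rel a b (x + n) (a + n) ∨ mergeRel π.rel a b (x + n) (b + n) := fun hx =>
      hx.imp (fun hx => Or.inl (hπ.shift hx)) fun hx => Or.inl (hπ.shift hx)
    have shift2 : ∀ {x y}, mergeRel π.rel a b x y →
        mergeRel (mergeRel π.rel a b) (a + n) (b + n) (x + n) (y + n) := by
      rintro x y (hxy | ⟨hx, hy⟩)
      · exact Or.inl (Or.inl (hπ.shift hxy))
      · exact Or.inr ⟨shift1 hx, shift1 hy⟩
    have hba : mergeRel (mergeRel π.rel a b) (a + n) (b + n) b a :=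
      Or.inl (Or.inr ⟨Or.inr (hπ.refl b), Or.inl (hπ.refl a)⟩)
    have toA : ∀ {x}, mergeRel π.rel a b x (a + n) ∨ mergeRel π.rel a b x (b + n) →
        mergeRel (mergeRel π.rel a b) (a + n) (b + n) (x + n) a := by
      have hn2 : ∀ c : ℤ, c + n + n = c + 2 * n := fun c => by ring
      rintro x (hx | hx)
      · have := shift2 hx
        rw [hn2] at this
        exact h2.trans this (h2.symm (h2.period a))
      · have := shift2 hx
        rw [hn2] at this
        exact h2.trans this (h2.trans (h2.symm (h2.period b)) hba)
    rcases hij with hij | ⟨hi, hj⟩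
    · exact shift2 hij
    · exact h2.trans (toA hi) (h2.symm (toA hj))
  have hlt : π < ofRel hB := by
    refine lt_of_le_of_ne (fun {x y} hxy => ?_) fun heq => hr ?_
    · rw [← rel_circlePos] at hxy
      exact rel_circlePos (ofRel hB) |>.1 ((rel_ofRel hB).2 (Or.inl (Or.inl hxy)))
    · rw [heq, rel_ofRel]
      exact Or.inl (Or.inr ⟨Or.inl (hπ.refl a), Or.inr (hπ.refl b)⟩)
  have hle3 : ofRel hB ≤ π' := fun {x y} hxy => by
    rw [← rel_circlePos, rel_ofRel] at hxy
    exact (rel_circlePos π').1 (hle2 hxy)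
  have heq : ofRel hB = π' := (eq_or_lt_of_le hle3).resolve_right (h.2 hlt)
  exact ⟨a, b, fun i j => by rw [← heq, rel_ofRel]⟩

theorem card_openers_le_of_covBy {π π' : NCB n} (h : π ⋖ π') :
    π.openers.card ≤ π'.openers.card + 1 := by
  obtain ⟨a, b, hab⟩ := exists_mergeRel_of_covBy h
  let s : Setoid (SignedSymbol n) :=
    ⟨mergeRel π.1 (ofInt n a) (ofInt n b), mergeRel_equivalence π.1.iseqv _ _⟩
  have h1 : Nat.card (Quotient π.1) ≤ Nat.card (Quotient s) + 1 :=
    card_quotient_le_of_mergeRel fun _ _ hxy => hxy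
  have h2 : Nat.card (Quotient s) ≤ Nat.card (Quotient π'.1) + 1 := by
    refine card_quotient_le_of_mergeRel (a := ofInt n (a + n)) (b := ofInt n (b + n))
      fun x y hxy => ?_
    rw [← rel_circlePos, hab] at hxy
    simp only [mergeRel, rel, ofInt_circlePos] at hxy
    exact hxy
  have h3 := π.two_mul_card_openers_le
  have h4 := π'.card_quotient_le
  omega

theorem rank_discrete : (discrete n).rank = 0 := by
  have hn : (0 : ℤ) < n := by exact_mod_cast NeZero.pos n
  rw [rank_eq, Finset.card_eq_zero, Finset.compl_eq_empty_iff, Finset.eq_univ_iff_forall]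
  intro i
  rw [mem_openers]
  intro b hb hbi hr
  have h1 := (ofInt_eq_iff (n := n)).1 (show ofInt n b = ofInt n i from hr)
  have h3 := Int.dvd_of_emod_eq_zero (Int.emod_eq_emod_iff_emod_sub_eq_zero.1 h1.symm)
  have h4 := Int.le_of_dvd (by omega) h3
  omega

theorem isRankFunction_rank_of_neZero : IsRankFunction (rank : NCB n → ℕ) := by
  constructor
  · intro π hπ
    have : discrete n ≤ π := fun {x y} hxy => by
      rw [show x = y from hxy]
    rw [← hπ.eq_of_le this, rank_discrete]
  · intro π π' h
    have h1 := Finset.card_lt_card (openers_ssubset_of_lt h.lt)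
    have h2 := card_openers_le_of_covBy h
    have h3 := Finset.card_le_univ π.openers
    rw [rank_eq, rank_eq, Finset.card_compl, Finset.card_compl]
    omega

end Unroll

end NCB

/-! ### The extension -/

theorem exists_equiv_NCB_PB_of_neZero (n : ℕ) [NeZero n] :
    ∃ f : NCB n ≃ PB n, (∀ π π' : NCB n, π < π' → f π < f π') ∧ ∀ π, (f π).rank = π.rank := by
  let f : NCB n ≃ PB n := (Equiv.ofBijective NCB.toPair
    ⟨NCB.toPair_injective, NCB.toPair_surjective⟩).trans (PB.pairEquiv n).symm
  have hf : ∀ π, (f π).barredPositions = π.openersᶜ := fun π =>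
    PB.barredPositions_pairEquiv_symm _
  refine ⟨f, fun π π' h => ?_, fun π => ?_⟩
  · rw [PB.lt_iff, hf, hf, Finset.compl_ssubset_compl]
    exact NCB.openers_ssubset_of_lt h
  · rw [PB.rank_eq, hf, NCB.rank_eq]

instance NCB.instSubsingletonZero : Subsingleton (NCB 0) :=
  ⟨fun _ _ => Subtype.ext (Setoid.ext fun x => x.1.elim0)⟩

theorem exists_equiv_NCB_PB (n : ℕ) :
    ∃ f : NCB n ≃ PB n, (∀ π π' : NCB n, π < π' → f π < f π') ∧ ∀ π, (f π).rank = π.rank := by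
  rcases Nat.eq_zero_or_pos n with rfl | hn
  · have : Subsingleton (PB 0) := ⟨fun _ _ => Subtype.ext (Subtype.ext (funext fun i => i.elim0))⟩
    obtain ⟨b, -⟩ := PB.exists_barredPositions_eq (∅ : Finset (Fin 0))
    refine ⟨⟨fun _ => b, fun _ => NCB.discrete 0, fun _ => Subsingleton.elim _ _,
      fun _ => Subsingleton.elim _ _⟩, fun π π' h => ?_, fun π => ?_⟩
    · exact absurd (Subsingleton.elim π π') h.ne
    · rw [NCB.rank, Nat.zero_sub]
      exact Nat.le_zero.1 (PB.rank_le _)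
  · have : NeZero n := ⟨hn.ne'⟩
    exact exists_equiv_NCB_PB_of_neZero n

theorem NCB.isRankFunction_rank (n : ℕ) : IsRankFunction (NCB.rank : NCB n → ℕ) := by
  rcases Nat.eq_zero_or_pos n with rfl | hn
  · exact ⟨fun π _ => by rw [NCB.rank, Nat.zero_sub],
      fun π π' h => absurd (Subsingleton.elim π π') h.lt.ne⟩
  · have : NeZero n := ⟨hn.ne'⟩
    exact NCB.isRankFunction_rank_of_neZero

theorem mainTheorem5 (n : ℕ) :
    (∃ f : NCB n ≃ PB n, ∀ π π' : NCB n, π < π' → f π < f π') ∧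
    IsRankFunction (NCB.rank : NCB n → ℕ) ∧
    IsRankFunction (PB.rank : PB n → ℕ) ∧
    rankGenFun (PB.rank : PB n → ℕ) = rankGenFun (NCB.rank : NCB n → ℕ) ∧
    (∀ k : ℕ, rankSize (PB.rank : PB n → ℕ) k = n.choose k ^ 2) ∧
    RankSymmetric (PB.rank : PB n → ℕ) ∧
    RankUnimodal (PB.rank : PB n → ℕ) ∧
    SelfDual (PB n) ∧
    StronglySperner (PB.rank : PB n → ℕ) := by
  obtain ⟨f, hlt, hrank⟩ := exists_equiv_NCB_PB n
  refine ⟨⟨f, hlt⟩, NCB.isRankFunction_rank n, PB.isRankFunction_rank, ?_, PB.rankSize_rank,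
    PB.rankSymmetric_rank, PB.rankUnimodal_rank, PB.selfDual, PB.stronglySperner_rank⟩
  rw [rankGenFun, rankGenFun, ← Equiv.sum_comp f]
  exact Finset.sum_congr rfl fun π _ => by rw [hrank]
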